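/- Given $\varepsilon=(\varepsilon_y)_{y\in\mathbb Z}\in\{-1,1\}^{\mathbb Z}$, let $\mathbb Z^2_\varepsilon$ be the directed graph with vertex set $\mathbb Z^2$ in which there is an edge from $(x,y)$ to each of the three vertices $(x,y+1)$, $(x,y-1)$ and $(x+\varepsilon_y,y)$, and no other edge. The simple random walk on $\mathbb Z^2_\varepsilon$ is the Markov chain on $\mathbb Z^2$ that jumps along each of the three edges leaving its current position with probability $1/3$. It is called recurrent if, from every starting vertex $u$, it returns to $u$ with probability $1$, and transient if, from every starting vertex $u$, it returns to $u$ with probability strictly less than $1$. Let $Q\ge 2$ be an even integer and let $f:\mathbb Z\to\{-1,1\}$ be $Q$-periodic with $\sum_{y=1}^{Q}f(y)=0$. On a probability space $(\Omega,\mathcal A,\mathbb P)$ let $\rho=(\rho_y)_{y\in\mathbb Z}$ be independent random variables, uniformly distributed on $\{-1,1\}$, and let $\lambda=(\lambda_y)_{y\in\mathbb Z}$ be independent $\{0,1\}$-valued random variables such that the sequence $\lambda$ is independent of the sequence $\rho$. Suppose that there are real constants $\beta$ and $c\ge 0$ such that $$\mathbb P(\lambda_y=1)=(1+o(1))\,\frac{c}{|y|^{\beta}}\qquad\text{as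 }|y|\to\infty .$$ Put $\varepsilon_y=(1-\lambda_y)f(y)+\lambda_y\rho_y$ for $y\in\mathbb Z$. 1. If $\beta<1$ and $c>0$, then for almost every realisation of $(\lambda,\rho)$ the simple random walk on $\mathbb Z^2_\varepsilon$ is transient. 2. If $\beta>1$, then for almost every realisation of $(\lambda,\rho)$ the simple random walk on $\mathbb Z^2_\varepsilon$ is recurrent. -/

import Mathlib

open MeasureTheory ProbabilityTheory Filter
open scoped ENNReal

/-- `AllowedEdge ε u v`: the pair `(u, v)` is an edge of the directed lattice. Vertical edges can be
traversed both ways; the horizontal row of ordinate `y` is one-way, in direction `ε y`.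
The first component of a vertex is its abscissa, the second one its ordinate. -/
def AllowedEdge (ε : ℤ → ℤ) (u v : ℤ × ℤ) : Prop :=
  (v.1 = u.1 ∧ (v.2 = u.2 + 1 ∨ v.2 = u.2 - 1)) ∨ (v.2 = u.2 ∧ v.1 = u.1 + ε u.2)

open Classical in
/-- Transition matrix of the simple random walk on the directed lattice. -/
noncomputable def walkMatrix (ε : ℤ → ℤ) (u v : ℤ × ℤ) : ℝ≥0∞ :=
  if AllowedEdge ε u v then 1 / 3 else 0

/-- The three out-neighbours of a vertex. -/
def outNeighbours (ε : ℤ → ℤ) (u : ℤ × ℤ) : Finset (ℤ × ℤ) :=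
  {(u.1, u.2 + 1), (u.1, u.2 - 1), (u.1 + ε u.2, u.2)}

theorem mem_outNeighbours (ε : ℤ → ℤ) (u v : ℤ × ℤ) :
    v ∈ outNeighbours ε u ↔ AllowedEdge ε u v := by
  obtain ⟨a, b⟩ := v
  simp only [outNeighbours, AllowedEdge, Finset.mem_insert, Finset.mem_singleton, Prod.mk.injEq]
  tauto

theorem card_outNeighbours (ε : ℤ → ℤ) (u : ℤ × ℤ) : (outNeighbours ε u).card = 3 := by
  rw [outNeighbours, Finset.card_eq_three]
  refine ⟨_, _, _, ?_, ?_, ?_, rfl⟩ <;> simp only [ne_eq, Prod.mk.injEq] <;> omega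

theorem sum_walkMatrix (ε : ℤ → ℤ) (u : ℤ × ℤ) :
    ∑ v ∈ outNeighbours ε u, walkMatrix ε u v = 1 := by
  have h : ∀ v ∈ outNeighbours ε u, walkMatrix ε u v = 1 / 3 := fun v hv =>
    if_pos ((mem_outNeighbours ε u v).1 hv)
  rw [Finset.sum_congr rfl h, Finset.sum_const, card_outNeighbours, nsmul_eq_mul, one_div]
  exact ENNReal.mul_inv_cancel (by simp) (by simp)

/-- The row of the transition matrix at `u`, as a probability mass function. -/
noncomputable def walkStep (ε : ℤ → ℤ) (u : ℤ × ℤ) : PMF (ℤ × ℤ) :=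
  PMF.ofFinset (walkMatrix ε u) (outNeighbours ε u) (sum_walkMatrix ε u)
    fun v hv => if_neg fun h => hv ((mem_outNeighbours ε u v).2 h)

/-- The one-step kernel of the simple random walk: given the positions up to time `n`, the position
at time `n + 1` is distributed according to the row of the transition matrix at the position at
time `n`. -/
noncomputable def walkKernel (ε : ℤ → ℤ) (n : ℕ) :
    Kernel (Π _ : Finset.Iic n, ℤ × ℤ) (ℤ × ℤ) :=
  Kernel.ofFunOfCountable fun h => (walkStep ε (h ⟨n, Finset.mem_Iic.2 le_rfl⟩)).toMeasure

instance walkKernel_isMarkovKernel (ε : ℤ → ℤ) (n : ℕ) : IsMarkovKernel (walkKernel ε n) :=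
  ⟨fun h => inferInstanceAs (IsProbabilityMeasure
    (walkStep ε (h ⟨n, Finset.mem_Iic.2 le_rfl⟩)).toMeasure)⟩

/-- The law, on the space of trajectories `ℕ → ℤ × ℤ`, of the simple random walk started
at `u`. -/
noncomputable def walkLaw (ε : ℤ → ℤ) (u : ℤ × ℤ) : Measure (ℕ → ℤ × ℤ) :=
  Kernel.traj (X := fun _ => ℤ × ℤ) (walkKernel ε) 0 fun _ => u

/-- The probability that the walk started at `u` ever returns to `u`. -/
noncomputable def returnProb (ε : ℤ → ℤ) (u : ℤ × ℤ) : ℝ≥0∞ :=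
  walkLaw ε u {M | ∃ n : ℕ, 1 ≤ n ∧ M n = u}

/-- The simple random walk is recurrent: from every vertex it returns almost surely. -/
def WalkRecurrent (ε : ℤ → ℤ) : Prop :=
  ∀ u : ℤ × ℤ, returnProb ε u = 1

/-- The simple random walk is transient: from every vertex, with positive probability, it never
returns. -/
def WalkTransient (ε : ℤ → ℤ) : Prop :=
  ∀ u : ℤ × ℤ, returnProb ε u < 1

/-- The orientation of the rows: the direction is `f y` at the rows without defect
(`lam y = 0`) and `rho y` at the rows with a defect (`lam y = 1`). -/
def orientation (f lam rho : ℤ → ℤ) (y : ℤ) : ℤ :=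
  (1 - lam y) * f y + lam y * rho y

/-! By renewal theory the walk is transient exactly when the return probabilities `stepProb ε u n u`
are summable. The direction of a horizontal move depends only on the ordinate, so a Fourier
transform in the abscissa reduces the problem to one dimension: at frequency θ and discount `r`, the
Green function G = A + iB seen from the row `o` solves (m - κΔ - iτε)G = δ_o with m = 1 - r + r(1 -
cos θ)/3, κ = r/3 and τ = r sin θ/3. Up to the factor 2π, the discounted sum of return probabilities
is the integral of A(o) over θ. When 1 - r ≤ θ² and θ is small, m is of order θ² and τ of order θ,
and the question is whether A(o) stays integrable at θ = 0 as r tends to 1. The basic tool is the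
energy identity m‖G‖² + κ‖∇G‖² = A(o): both bounds come from testing the equations against a
well-chosen function and applying Cauchy–Schwarz with this energy.

Recurrence. If ε is the difference sequence of a bounded F, the real equation is tested against a
tent of width 1/θ, and a summation by parts moves the difference off F. This gives A(o) ≥ const/θ
(`bounded_primitive_bound`, `greenAmp_lower_bound`), whose integral diverges logarithmically. A
periodic f of zero mean has a bounded primitive; for β > 1 Borel–Cantelli leaves finitely many
defects, and these change the primitive by a bounded amount.

Transience. Let T be the squared ℓ² norm of the centred partial sums of ε over a window of scale R
near `o`. Testing the imaginary equation against a second primitive of ε shows that A(o) is at most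
of order R, or at most of order (mR² + κ)/(τ²T) (`window_bound`). If T ≥ R^(1+δ) at all large dyadic
scales, taking R = |θ|^(-p) for a suitable p < 1 gives an integrable bound. For β < 1 such windows
exist almost surely: a Fourier small-ball estimate makes small block sums unlikely, Markov's
inequality bounds the probability that half the blocks of a window have small sums, and
Borel–Cantelli runs over the dyadic scales. -/

/-! ### Markov property, renewal equation and the summability criterion -/

/-- One step of the forward evolution: the mass at `v` comes from the three in-neighbours of `v`. -/
noncomputable def pushStep (ε : ℤ → ℤ) (φ : ℤ × ℤ → ℝ) (v : ℤ × ℤ) : ℝ :=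
  (φ (v.1, v.2 - 1) + φ (v.1, v.2 + 1) + φ (v.1 - ε v.2, v.2)) / 3

/-- The probability that the walk started at `u` is at `v` at time `n`. -/
noncomputable def stepProb (ε : ℤ → ℤ) (u : ℤ × ℤ) : ℕ → ℤ × ℤ → ℝ
  | 0 => fun v => if v = u then 1 else 0
  | n + 1 => pushStep ε (stepProb ε u n)

/-- The probability that the walk started at `u` is at `v` at time `n + 1`, without having
returned to `u` at the times `1, …, n`. -/
noncomputable def tabooProb (ε : ℤ → ℤ) (u : ℤ × ℤ) (n : ℕ) (v : ℤ × ℤ) : ℝ :=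
  (walkLaw ε u).real {M | M (n + 1) = v ∧ ∀ k < n, M (k + 1) ≠ u}

instance walkLaw_isProbabilityMeasure (ε : ℤ → ℤ) (u : ℤ × ℤ) :
    IsProbabilityMeasure (walkLaw ε u) := by
  unfold walkLaw; infer_instance

theorem walkKernel_apply_singleton (ε : ℤ → ℤ) (n : ℕ) (h : Π _ : Finset.Iic n, ℤ × ℤ)
    (v : ℤ × ℤ) :
    walkKernel ε n h {v} = walkMatrix ε (h ⟨n, Finset.mem_Iic.2 le_rfl⟩) v := by
  simp only [walkKernel]
  change (walkStep ε (h ⟨n, Finset.mem_Iic.2 le_rfl⟩)).toMeasure {v} = _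
  rw [PMF.toMeasure_apply_singleton _ _ (measurableSet_singleton v)]
  rfl

/-- The matrix read by columns, through the three predecessors of `v`. The horizontal predecessor
lies in the same row as `v`, which is why its shift is `ε v.2`. -/
theorem walkMatrix_eq_indicator (ε : ℤ → ℤ) (w v : ℤ × ℤ) :
    walkMatrix ε w v = ({(v.1, v.2 - 1)} : Set (ℤ × ℤ)).indicator (fun _ => 1 / 3) w
      + ({(v.1, v.2 + 1)} : Set (ℤ × ℤ)).indicator (fun _ => 1 / 3) w
      + ({(v.1 - ε v.2, v.2)} : Set (ℤ × ℤ)).indicator (fun _ => 1 / 3) w := by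
  obtain ⟨a, b⟩ := v
  obtain ⟨x, y⟩ := w
  have key : AllowedEdge ε (x, y) (a, b) ↔
      ((x = a ∧ y = b - 1) ∨ (x = a ∧ y = b + 1)) ∨ (x = a - ε b ∧ y = b) := by
    constructor
    · rintro (⟨h1, h2⟩ | ⟨h1, h2⟩) <;> dsimp only at h1 h2
      · omega
      · subst h1; omega
    · rintro (h | ⟨h1, h2⟩)
      · exact Or.inl ⟨by dsimp only; omega, by dsimp only; omega⟩
      · subst h2; exact Or.inr ⟨rfl, by dsimp only; omega⟩
  simp only [walkMatrix, key, Set.indicator_apply, Set.mem_singleton_iff, Prod.mk.injEq]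
  by_cases h1 : x = a ∧ y = b - 1
  · rw [if_pos (Or.inl (Or.inl h1)), if_pos h1, if_neg (by omega), if_neg (by omega)]; simp
  by_cases h2 : x = a ∧ y = b + 1
  · rw [if_pos (Or.inl (Or.inr h2)), if_neg h1, if_pos h2, if_neg (by omega)]; simp
  by_cases h3 : x = a - ε b ∧ y = b
  · rw [if_pos (Or.inr h3), if_neg h1, if_neg h2, if_pos h3]; simp
  · rw [if_neg (by tauto), if_neg h1, if_neg h2, if_neg h3]; simp

/-- The Markov property: the joint law of the past up to time `n` and of the next position is the
composition-product of the law of the past with the kernel. The event `B` lets the past carry the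
taboo condition. -/
theorem walkLaw_next (ε : ℤ → ℤ) (u : ℤ × ℤ) (n : ℕ) (v : ℤ × ℤ)
    (B : Set (Π _ : Finset.Iic n, ℤ × ℤ)) :
    (walkLaw ε u).real {M | Preorder.frestrictLe n M ∈ B ∧ M (n + 1) = v} =
      pushStep ε (fun w => (walkLaw ε u).real {M | Preorder.frestrictLe n M ∈ B ∧ M n = w}) v := by
  have hB : MeasurableSet B := B.to_countable.measurableSet
  have hmf : Measurable (Preorder.frestrictLe (π := fun _ : ℕ => ℤ × ℤ) n) :=
    Preorder.measurable_frestrictLe n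
  have key : walkLaw ε u {M | Preorder.frestrictLe n M ∈ B ∧ M (n + 1) = v} =
      ∫⁻ h in B, walkMatrix ε (h ⟨n, Finset.mem_Iic.2 le_rfl⟩) v
        ∂((walkLaw ε u).map (Preorder.frestrictLe n)) := by
    have h1 := Kernel.partialTraj_compProd_eq_map_traj (X := fun _ => ℤ × ℤ)
      (κ := walkKernel ε) (Nat.zero_le n) (x₀ := fun _ => u)
    have h2 := congrArg (fun m => m (B ×ˢ {v})) h1
    rw [Measure.map_apply (hmf.prodMk (measurable_pi_apply _))
      (hB.prod (measurableSet_singleton v)), Measure.compProd_apply_prod hB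
      (measurableSet_singleton v), ← Kernel.traj_map_frestrictLe_apply] at h2
    rw [walkLaw]
    simp_rw [← walkKernel_apply_singleton]
    rw [h2]
    rfl
  have hpt : ∀ w, ∫⁻ h in B, ({w} : Set (ℤ × ℤ)).indicator (fun _ => (1 / 3 : ℝ≥0∞))
        (h ⟨n, Finset.mem_Iic.2 le_rfl⟩) ∂((walkLaw ε u).map (Preorder.frestrictLe n)) =
      1 / 3 * walkLaw ε u {M | Preorder.frestrictLe n M ∈ B ∧ M n = w} := by
    intro w
    have : (fun h : (Π _ : Finset.Iic n, ℤ × ℤ) =>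
        ({w} : Set (ℤ × ℤ)).indicator (fun _ => (1 / 3 : ℝ≥0∞)) (h ⟨n, Finset.mem_Iic.2 le_rfl⟩))
        = ({h | h ⟨n, Finset.mem_Iic.2 le_rfl⟩ = w} : Set _).indicator (fun _ => 1 / 3) := by
      ext h; simp [Set.indicator_apply]
    have hm : MeasurableSet {h : (Π _ : Finset.Iic n, ℤ × ℤ) |
        h ⟨n, Finset.mem_Iic.2 le_rfl⟩ = w} := (Set.to_countable _).measurableSet
    rw [this, lintegral_indicator_const hm, Measure.restrict_apply hm,
      Measure.map_apply hmf (hm.inter hB)]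
    congr 2
    ext M
    simp [Preorder.frestrictLe, and_comm]
  simp_rw [walkMatrix_eq_indicator] at key
  have hmeas : ∀ w, Measurable fun h : (Π _ : Finset.Iic n, ℤ × ℤ) =>
      ({w} : Set (ℤ × ℤ)).indicator (fun _ => (1 / 3 : ℝ≥0∞))
        (h ⟨n, Finset.mem_Iic.2 le_rfl⟩) := fun w =>
    (measurable_of_countable _ : Measurable (({w} : Set (ℤ × ℤ)).indicator
      (fun _ => (1 / 3 : ℝ≥0∞)))).comp (measurable_pi_apply _)
  rw [lintegral_add_right _ (hmeas _), lintegral_add_right _ (hmeas _), hpt, hpt, hpt,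
    ← mul_add, ← mul_add] at key
  simp only [Measure.real, pushStep]
  rw [key, ENNReal.toReal_mul, ENNReal.toReal_add (by simp) (by simp),
    ENNReal.toReal_add (by simp) (by simp)]
  simp
  ring

theorem walkLaw_start (ε : ℤ → ℤ) (u : ℤ × ℤ) : ∀ᵐ M ∂(walkLaw ε u), M 0 = u := by
  have h := Kernel.traj_map_frestrictLe_apply (X := fun _ => ℤ × ℤ) (κ := walkKernel ε) 0 0
    (fun _ => u)
  rw [Kernel.partialTraj_self, Kernel.id_apply] at h
  have h2 : ∀ᵐ x ∂((walkLaw ε u).map (Preorder.frestrictLe 0)),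
      x ⟨0, Finset.mem_Iic.2 le_rfl⟩ = u := by
    rw [walkLaw, h, ae_dirac_iff ((Set.to_countable _).measurableSet)]
  exact ae_of_ae_map (Preorder.measurable_frestrictLe 0).aemeasurable h2

theorem tabooProb_zero (ε : ℤ → ℤ) (u : ℤ × ℤ) :
    tabooProb ε u 0 = pushStep ε (stepProb ε u 0) := by
  funext v
  have h := walkLaw_next ε u 0 v Set.univ
  simp only [Set.mem_univ, true_and] at h
  have h2 : (fun w => (walkLaw ε u).real {M | M 0 = w}) = stepProb ε u 0 := by
    funext w
    have hstart := walkLaw_start ε u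
    by_cases hw : w = u
    · subst hw
      simp only [stepProb, if_true, Measure.real]
      rw [(mem_ae_iff_prob_eq_one
        (measurableSet_eq_fun (measurable_pi_apply 0) measurable_const)).1 hstart]
      simp
    · simp only [stepProb, if_neg hw]
      have : {M : ℕ → ℤ × ℤ | M 0 = w} ⊆ {M | M 0 = u}ᶜ := by
        intro M (hM : M 0 = w) (hM' : M 0 = u)
        exact hw (hM.symm.trans hM')
      rw [Measure.real, measure_mono_null this hstart]
      simp
  simp only [tabooProb, not_lt_zero, false_imp_iff, implies_true, and_true]
  rw [h, h2]

theorem tabooProb_succ (ε : ℤ → ℤ) (u : ℤ × ℤ) (n : ℕ) :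
    tabooProb ε u (n + 1) = pushStep ε (fun w => if w = u then 0 else tabooProb ε u n w) := by
  funext v
  have h := walkLaw_next ε u (n + 1) v
    {h | ∀ k, ∀ hk : k < n + 1, h ⟨k + 1, Finset.mem_Iic.2 hk⟩ ≠ u}
  have e1 : ∀ M : ℕ → ℤ × ℤ, Preorder.frestrictLe (n + 1) M ∈
      {h : (Π _ : Finset.Iic (n + 1), ℤ × ℤ) |
        ∀ k, ∀ hk : k < n + 1, h ⟨k + 1, Finset.mem_Iic.2 hk⟩ ≠ u} ↔
      ∀ k < n + 1, M (k + 1) ≠ u := fun M => Iff.rfl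
  simp only [e1] at h
  simp only [tabooProb]
  have e2 : (fun w => if w = u then 0 else
      (walkLaw ε u).real {M | M (n + 1) = w ∧ ∀ k < n, M (k + 1) ≠ u}) =
      fun w => (walkLaw ε u).real {M | (∀ k < n + 1, M (k + 1) ≠ u) ∧ M (n + 1) = w} := by
    funext w
    split_ifs with hw
    · symm
      convert measureReal_empty using 2
      ext M
      simp only [Set.mem_ofPred_eq, Set.mem_empty_iff_false, iff_false, not_and]
      intro h1 h2
      exact h1 n (Nat.lt_succ_self n) (h2.trans hw)
    · congr 1
      ext M
      simp only [Set.mem_ofPred_eq]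
      constructor
      · rintro ⟨h1, h2⟩
        refine ⟨fun k hk => ?_, h1⟩
        rcases Nat.lt_succ_iff_lt_or_eq.1 hk with h | h
        · exact h2 k h
        · rw [h, h1]; exact hw
      · rintro ⟨h1, h2⟩
        exact ⟨h2, fun k hk => h1 k (hk.trans (Nat.lt_succ_self n))⟩
  rw [e2, ← h]
  congr 1
  ext M
  simp [and_comm]

theorem pushStep_add (ε : ℤ → ℤ) (φ ψ : ℤ × ℤ → ℝ) :
    pushStep ε (fun w => φ w + ψ w) = fun v => pushStep ε φ v + pushStep ε ψ v := by
  funext v; simp only [pushStep]; ring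

theorem pushStep_const_mul (ε : ℤ → ℤ) (a : ℝ) (φ : ℤ × ℤ → ℝ) :
    pushStep ε (fun w => a * φ w) = fun v => a * pushStep ε φ v := by
  funext v; simp only [pushStep]; ring

theorem pushStep_sum (ε : ℤ → ℤ) (s : Finset ℕ) (φ : ℕ → ℤ × ℤ → ℝ) :
    pushStep ε (fun w => ∑ k ∈ s, φ k w) = fun v => ∑ k ∈ s, pushStep ε (φ k) v := by
  funext v
  simp only [pushStep, Finset.sum_div, Finset.sum_add_distrib, add_div]

theorem stepProb_nonneg (ε : ℤ → ℤ) (u : ℤ × ℤ) (n : ℕ) (v : ℤ × ℤ) : 0 ≤ stepProb ε u n v := by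
  induction n generalizing v with
  | zero => simp only [stepProb]; split_ifs <;> norm_num
  | succ n ih =>
    have h1 := ih (v.1, v.2 - 1)
    have h2 := ih (v.1, v.2 + 1)
    have h3 := ih (v.1 - ε v.2, v.2)
    simp only [stepProb, pushStep]
    positivity

theorem tabooProb_nonneg (ε : ℤ → ℤ) (u : ℤ × ℤ) (n : ℕ) (v : ℤ × ℤ) : 0 ≤ tabooProb ε u n v :=
  measureReal_nonneg

/-- Decomposition of the walk at its last return to the starting point. -/
theorem stepProb_succ_eq (ε : ℤ → ℤ) (u : ℤ × ℤ) (n : ℕ) (v : ℤ × ℤ) :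
    stepProb ε u (n + 1) v = tabooProb ε u n v +
      ∑ k ∈ Finset.range n, tabooProb ε u k u * stepProb ε u (n - k) v := by
  induction n generalizing v with
  | zero => simp [tabooProb_zero, stepProb]
  | succ n ih =>
    -- The mass that returns to `u` for the first time at time `n + 1` restarts as a fresh walk at
    -- its time `0`; the rest keeps evolving under the taboo.
    have e : tabooProb ε u n = fun w => (if w = u then 0 else tabooProb ε u n w) +
        tabooProb ε u n u * stepProb ε u 0 w := by
      funext w
      by_cases hw : w = u <;> simp [hw, stepProb]
    rw [stepProb, funext ih, pushStep_add, pushStep_sum, Finset.sum_range_succ, tabooProb_succ]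
    simp only [pushStep_const_mul]
    conv_lhs => rw [e, pushStep_add, pushStep_const_mul]
    have e2 : ∀ k ∈ Finset.range n, tabooProb ε u k u * pushStep ε (stepProb ε u (n - k)) v =
        tabooProb ε u k u * stepProb ε u (n + 1 - k) v := by
      intro k hk
      rw [Nat.succ_sub (Finset.mem_range.1 hk).le]
      rfl
    rw [Finset.sum_congr rfl e2, Nat.add_sub_cancel_left]
    simp only [stepProb]
    ring

/-- Renewal equation for the returns to the starting point. -/
theorem stepProb_renewal (ε : ℤ → ℤ) (u : ℤ × ℤ) (n : ℕ) :
    stepProb ε u (n + 1) u =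
      ∑ k ∈ Finset.range (n + 1), tabooProb ε u k u * stepProb ε u (n - k) u := by
  rw [stepProb_succ_eq, Finset.sum_range_succ, Nat.sub_self]
  simp [stepProb, add_comm]

theorem hasSum_tabooProb (ε : ℤ → ℤ) (u : ℤ × ℤ) :
    HasSum (fun n => tabooProb ε u n u) (returnProb ε u).toReal := by
  have hset : {M : ℕ → ℤ × ℤ | ∃ n : ℕ, 1 ≤ n ∧ M n = u} =
      ⋃ n : ℕ, {M | M (n + 1) = u ∧ ∀ k < n, M (k + 1) ≠ u} := by
    classical
    ext M
    simp only [Set.mem_ofPred_eq, Set.mem_iUnion]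
    constructor
    · rintro ⟨n, hn, hM⟩
      have hex : ∃ m, M (m + 1) = u := ⟨n - 1, by rwa [Nat.sub_add_cancel hn]⟩
      exact ⟨Nat.find hex, Nat.find_spec hex, fun k hk => Nat.find_min hex hk⟩
    · rintro ⟨n, hn, -⟩
      exact ⟨n + 1, by omega, hn⟩
  have hdisj : Pairwise (Function.onFun Disjoint
      fun n : ℕ => {M : ℕ → ℤ × ℤ | M (n + 1) = u ∧ ∀ k < n, M (k + 1) ≠ u}) := by
    intro i j hij
    rw [Function.onFun, Set.disjoint_left]
    rintro M ⟨h1, h2⟩ ⟨h3, h4⟩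
    rcases lt_or_gt_of_ne hij with h | h
    · exact h4 i h h1
    · exact h2 j h h3
  have hmeas : ∀ n : ℕ, MeasurableSet
      {M : ℕ → ℤ × ℤ | M (n + 1) = u ∧ ∀ k < n, M (k + 1) ≠ u} := by
    intro n
    have h1 : ∀ m : ℕ, MeasurableSet {M : ℕ → ℤ × ℤ | M m = u} := fun m =>
      measurableSet_eq_fun (measurable_pi_apply m) measurable_const
    have : {M : ℕ → ℤ × ℤ | M (n + 1) = u ∧ ∀ k < n, M (k + 1) ≠ u} =
        {M | M (n + 1) = u} ∩ ⋂ k, ⋂ (_ : k < n), {M | M (k + 1) = u}ᶜ := by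
      ext M; simp
    rw [this]
    exact (h1 _).inter (MeasurableSet.iInter fun k => MeasurableSet.iInter fun _ => (h1 _).compl)
  have hsum : ∑' n, walkLaw ε u {M | M (n + 1) = u ∧ ∀ k < n, M (k + 1) ≠ u} =
      returnProb ε u := by
    rw [returnProb, hset, measure_iUnion hdisj hmeas]
  rw [← hsum, ENNReal.tsum_toReal_eq fun n => measure_ne_top _ _]
  exact (ENNReal.summable_toReal (by rw [hsum]; exact measure_ne_top _ _)).hasSum

theorem returnProb_le_one (ε : ℤ → ℤ) (u : ℤ × ℤ) : returnProb ε u ≤ 1 := prob_le_one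

/-- With F the return probability, the renewal equation bounds the sum of the `stepProb` at times 1
to N by F times the sum at times 0 to N - 1; if F < 1 the partial sums are therefore at most 1/(1 -
F). -/
theorem returnProb_lt_one_iff_summable (ε : ℤ → ℤ) (u : ℤ × ℤ) :
    returnProb ε u < 1 ↔ Summable fun n => stepProb ε u n u := by
  have hF := hasSum_tabooProb ε u
  constructor
  · intro h
    set F := (returnProb ε u).toReal with hFdef
    have hF1 : F < 1 := by
      rw [hFdef, ← ENNReal.toReal_one]
      exact (ENNReal.toReal_lt_toReal h.ne_top ENNReal.one_ne_top).2 h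
    have hF0 : 0 ≤ F := ENNReal.toReal_nonneg
    refine summable_of_sum_range_le (c := 1 / (1 - F)) (fun n => stepProb_nonneg ε u n u) fun N => ?_
    have hp : ∀ M, 0 ≤ ∑ n ∈ Finset.range M, stepProb ε u n u := fun M =>
      Finset.sum_nonneg fun n _ => stepProb_nonneg ε u n u
    have h1 : ∑ n ∈ Finset.range N, stepProb ε u (n + 1) u ≤
        F * ∑ n ∈ Finset.range N, stepProb ε u n u := by
      calc ∑ n ∈ Finset.range N, stepProb ε u (n + 1) u
          = ∑ n ∈ Finset.range N, ∑ k ∈ Finset.range (n + 1),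
              tabooProb ε u k u * stepProb ε u (n - k) u :=
            Finset.sum_congr rfl fun n _ => stepProb_renewal ε u n
        _ = ∑ k ∈ Finset.range N, ∑ n ∈ Finset.range (N - k),
              tabooProb ε u k u * stepProb ε u n u := by
            rw [Finset.sum_sigma', Finset.sum_sigma']
            refine Finset.sum_bij' (fun p _ => ⟨p.2, p.1 - p.2⟩) (fun p _ => ⟨p.1 + p.2, p.1⟩)
              ?_ ?_ ?_ ?_ ?_
            · rintro ⟨a, b⟩ h
              simp only [Finset.mem_sigma, Finset.mem_range] at h ⊢
              omega
            · rintro ⟨a, b⟩ h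
              simp only [Finset.mem_sigma, Finset.mem_range] at h ⊢
              omega
            · rintro ⟨a, b⟩ h
              simp only [Finset.mem_sigma, Finset.mem_range] at h
              have : b + (a - b) = a := by omega
              simp [this]
            · rintro ⟨a, b⟩ h
              simp
            · rintro ⟨a, b⟩ h
              rfl
        _ ≤ ∑ k ∈ Finset.range N, tabooProb ε u k u *
              ∑ n ∈ Finset.range N, stepProb ε u n u := by
            refine Finset.sum_le_sum fun k _ => ?_
            rw [← Finset.mul_sum]
            refine mul_le_mul_of_nonneg_left ?_ (tabooProb_nonneg ε u k u)
            exact Finset.sum_le_sum_of_subset_of_nonneg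
              (Finset.range_mono (Nat.sub_le _ _)) fun n _ _ => stepProb_nonneg ε u n u
        _ ≤ _ := by
            rw [← Finset.sum_mul]
            exact mul_le_mul_of_nonneg_right
              (sum_le_hasSum _ (fun k _ => tabooProb_nonneg ε u k u) hF) (hp N)
    have h2 : ∑ n ∈ Finset.range N, stepProb ε u n u ≤
        ∑ n ∈ Finset.range N, stepProb ε u (n + 1) u + 1 := by
      have := Finset.sum_range_succ' (fun n => stepProb ε u n u) N
      rw [Finset.sum_range_succ] at this
      have h3 := stepProb_nonneg ε u N u
      have h4 : stepProb ε u 0 u = 1 := by simp [stepProb]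
      linarith
    rw [le_div_iff₀ (by linarith)]
    linarith
  · intro h
    refine lt_of_le_of_ne (returnProb_le_one ε u) fun h1 => ?_
    rw [h1, ENNReal.toReal_one] at hF
    -- If F = 1 and the series converged, the Cauchy product would equate its sum with the same sum
    -- deprived of its initial term 1.
    have hprod := tsum_mul_tsum_eq_tsum_sum_range_of_summable_norm hF.summable.norm h.norm
    rw [hF.tsum_eq, one_mul] at hprod
    rw [h.tsum_eq_zero_add] at hprod
    simp only [stepProb_renewal] at hprod
    simp [stepProb] at hprod

/-! ### Fourier transform in the horizontal direction -/

/-- The Fourier transform in the horizontal direction of the law of the walk started in the row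
`o`, at frequency `θ` and time `n`. -/
noncomputable def rowAmp (ε : ℤ → ℤ) (o : ℤ) (θ : ℝ) : ℕ → ℤ → ℂ
  | 0 => fun y => if y = o then 1 else 0
  | n + 1 => fun y => (rowAmp ε o θ n (y - 1) + rowAmp ε o θ n (y + 1) +
      Complex.exp ((ε y : ℂ) * θ * Complex.I) * rowAmp ε o θ n y) / 3

/-- The generating function of `rowAmp`. -/
noncomputable def greenAmp (ε : ℤ → ℤ) (o : ℤ) (r θ : ℝ) (y : ℤ) : ℂ :=
  ∑' n : ℕ, (r : ℂ) ^ n * rowAmp ε o θ n y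

theorem integral_exp_int_mul (k : ℤ) :
    ∫ θ in -Real.pi..Real.pi, Complex.exp ((k : ℂ) * θ * Complex.I) =
      if k = 0 then 2 * (Real.pi : ℂ) else 0 := by
  split_ifs with hk
  · subst hk
    simp
    ring
  · have hc : (k : ℂ) * Complex.I ≠ 0 := by simp [hk]
    have h := integral_exp_mul_complex (a := -Real.pi) (b := Real.pi) hc
    have e : ∀ θ : ℝ, (k : ℂ) * θ * Complex.I = (k : ℂ) * Complex.I * θ := fun θ => by ring
    simp only [e]
    rw [h, div_eq_zero_iff, sub_eq_zero]
    left
    rw [Complex.exp_eq_exp_iff_exists_int]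
    exact ⟨k, by push_cast; ring⟩

theorem continuous_rowAmp (ε : ℤ → ℤ) (o : ℤ) (n : ℕ) (y : ℤ) :
    Continuous fun θ => rowAmp ε o θ n y := by
  induction n generalizing y with
  | zero => simp only [rowAmp]; exact continuous_const
  | succ n ih =>
    simp only [rowAmp]
    have h1 := ih (y - 1)
    have h2 := ih (y + 1)
    have h3 := ih y
    fun_prop

theorem integral_rowAmp (ε : ℤ → ℤ) (x₀ o : ℤ) (n : ℕ) (x y : ℤ) :
    ∫ θ in -Real.pi..Real.pi,
        Complex.exp (((x₀ - x : ℤ) : ℂ) * θ * Complex.I) * rowAmp ε o θ n y =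
      2 * Real.pi * (stepProb ε (x₀, o) n (x, y) : ℂ) := by
  induction n generalizing x y with
  | zero =>
    simp only [rowAmp, stepProb, Prod.mk.injEq]
    by_cases hy : y = o
    · simp only [hy, if_true, mul_one, and_true, integral_exp_int_mul]
      have : x₀ - x = 0 ↔ x = x₀ := by omega
      simp only [this]
      split_ifs <;> simp
    · simp [hy]
  | succ n ih =>
    have hci : ∀ x y : ℤ, IntervalIntegrable (fun θ : ℝ =>
        Complex.exp (((x₀ - x : ℤ) : ℂ) * θ * Complex.I) * rowAmp ε o θ n y) volume
        (-Real.pi) Real.pi := fun x y => by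
      have := continuous_rowAmp ε o n y
      exact Continuous.intervalIntegrable (by fun_prop) _ _
    have e : ∀ θ : ℝ, Complex.exp (((x₀ - x : ℤ) : ℂ) * θ * Complex.I) * rowAmp ε o θ (n + 1) y =
        (Complex.exp (((x₀ - x : ℤ) : ℂ) * θ * Complex.I) * rowAmp ε o θ n (y - 1) +
        Complex.exp (((x₀ - x : ℤ) : ℂ) * θ * Complex.I) * rowAmp ε o θ n (y + 1) +
        Complex.exp (((x₀ - (x - ε y) : ℤ) : ℂ) * θ * Complex.I) * rowAmp ε o θ n y) / 3 := by
      intro θ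
      have : ((x₀ - (x - ε y) : ℤ) : ℂ) * θ * Complex.I =
          ((x₀ - x : ℤ) : ℂ) * θ * Complex.I + (ε y : ℂ) * θ * Complex.I := by push_cast; ring
      rw [this, Complex.exp_add]
      simp only [rowAmp]
      ring
    simp only [e]
    rw [intervalIntegral.integral_div, intervalIntegral.integral_add ((hci _ _).add (hci _ _))
      (hci _ _), intervalIntegral.integral_add (hci _ _) (hci _ _), ih, ih, ih]
    simp only [stepProb, pushStep]
    push_cast
    ring

theorem summable_norm_shift {φ : ℤ → ℂ} (h : Summable fun y => ‖φ y‖) (a : ℤ) :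
    Summable (fun y => ‖φ (y + a)‖) ∧ ∑' y, ‖φ (y + a)‖ = ∑' y, ‖φ y‖ :=
  ⟨(Equiv.addRight a).summable_iff.2 h, (Equiv.addRight a).tsum_eq fun y => ‖φ y‖⟩

/-- Each step averages two shifts and one copy multiplied by unimodular phases, so the ℓ¹ norm
cannot grow. The resulting summability of the Green function in `y` justifies the later summations
by parts. -/
theorem summable_norm_rowAmp (ε : ℤ → ℤ) (o : ℤ) (θ : ℝ) (n : ℕ) :
    Summable (fun y => ‖rowAmp ε o θ n y‖) ∧ ∑' y, ‖rowAmp ε o θ n y‖ ≤ 1 := by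
  induction n with
  | zero =>
    have h : (fun y => ‖rowAmp ε o θ 0 y‖) = Pi.single o (1 : ℝ) := by
      funext y
      by_cases hy : y = o
      · subst hy; simp [rowAmp]
      · simp [rowAmp, hy]
    rw [h]
    refine ⟨(hasSum_pi_single o 1).summable, (hasSum_pi_single o (1 : ℝ)).tsum_eq.le⟩
  | succ n ih =>
    obtain ⟨hs, hle⟩ := ih
    obtain ⟨s1, e1⟩ := summable_norm_shift hs (-1)
    obtain ⟨s2, e2⟩ := summable_norm_shift hs 1
    have hb : ∀ y, ‖rowAmp ε o θ (n + 1) y‖ ≤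
        (‖rowAmp ε o θ n (y + -1)‖ + ‖rowAmp ε o θ n (y + 1)‖ + ‖rowAmp ε o θ n y‖) / 3 := by
      intro y
      simp only [rowAmp, norm_div, Complex.norm_ofNat]
      gcongr
      refine (norm_add₃_le).trans ?_
      rw [norm_mul, show (ε y : ℂ) * θ * Complex.I = ((ε y * θ : ℝ) : ℂ) * Complex.I by
        push_cast; ring, Complex.norm_exp_ofReal_mul_I, one_mul, sub_eq_add_neg]
    have hsum := ((s1.add s2).add hs).div_const 3
    have hs' := Summable.of_nonneg_of_le (fun y => norm_nonneg _) hb hsum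
    refine ⟨hs', (hs'.tsum_le_tsum hb hsum).trans ?_⟩
    rw [tsum_div_const, (s1.add s2).tsum_add hs, s1.tsum_add s2, e1, e2]
    linarith

theorem norm_rowAmp_le (ε : ℤ → ℤ) (o : ℤ) (θ : ℝ) (n : ℕ) (y : ℤ) : ‖rowAmp ε o θ n y‖ ≤ 1 := by
  obtain ⟨hs, hle⟩ := summable_norm_rowAmp ε o θ n
  exact (hs.le_tsum y fun j _ => norm_nonneg _).trans hle

theorem summable_greenAmp_prod (ε : ℤ → ℤ) (o : ℤ) {r : ℝ} (hr0 : 0 ≤ r) (hr1 : r < 1) (θ : ℝ) :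
    Summable fun p : ℤ × ℕ => ‖(r : ℂ) ^ p.2 * rowAmp ε o θ p.2 p.1‖ := by
  have h : Summable fun p : ℕ × ℤ => ‖(r : ℂ) ^ p.1 * rowAmp ε o θ p.1 p.2‖ := by
    rw [summable_prod_of_nonneg fun p => norm_nonneg _]
    simp only [norm_mul, norm_pow, Complex.norm_real, Real.norm_eq_abs, abs_of_nonneg hr0]
    refine ⟨fun n => (summable_norm_rowAmp ε o θ n).1.mul_left _, ?_⟩
    refine Summable.of_nonneg_of_le (fun n => tsum_nonneg fun y => by positivity) (fun n => ?_)
      (summable_geometric_of_lt_one hr0 hr1)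
    rw [tsum_mul_left]
    exact mul_le_of_le_one_right (by positivity) (summable_norm_rowAmp ε o θ n).2
  exact h.prod_symm

theorem summable_rowAmp_series (ε : ℤ → ℤ) (o : ℤ) {r : ℝ} (hr0 : 0 ≤ r) (hr1 : r < 1) (θ : ℝ)
    (y : ℤ) : Summable fun n : ℕ => (r : ℂ) ^ n * rowAmp ε o θ n y :=
  ((summable_greenAmp_prod ε o hr0 hr1 θ).prod_factor y).of_norm

theorem summable_norm_greenAmp (ε : ℤ → ℤ) (o : ℤ) {r : ℝ} (hr0 : 0 ≤ r) (hr1 : r < 1) (θ : ℝ) :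
    Summable fun y => ‖greenAmp ε o r θ y‖ :=
  Summable.of_nonneg_of_le (fun _ => norm_nonneg _)
    (fun _ => norm_tsum_le_tsum_norm ((summable_greenAmp_prod ε o hr0 hr1 θ).prod_factor _))
    (summable_greenAmp_prod ε o hr0 hr1 θ).prod

theorem greenAmp_eq (ε : ℤ → ℤ) (o : ℤ) {r : ℝ} (hr0 : 0 ≤ r) (hr1 : r < 1) (θ : ℝ) (y : ℤ) :
    greenAmp ε o r θ y = (if y = o then 1 else 0) + r / 3 * (greenAmp ε o r θ (y - 1) +
      greenAmp ε o r θ (y + 1) +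
      Complex.exp ((ε y : ℂ) * θ * Complex.I) * greenAmp ε o r θ y) := by
  have hs := summable_rowAmp_series ε o hr0 hr1 θ
  conv_lhs => rw [greenAmp, (hs y).tsum_eq_zero_add]
  have e : ∀ n : ℕ, (r : ℂ) ^ (n + 1) * rowAmp ε o θ (n + 1) y =
      r / 3 * ((r : ℂ) ^ n * rowAmp ε o θ n (y - 1) + (r : ℂ) ^ n * rowAmp ε o θ n (y + 1) +
        Complex.exp ((ε y : ℂ) * θ * Complex.I) * ((r : ℂ) ^ n * rowAmp ε o θ n y)) := by
    intro n; simp only [rowAmp]; ring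
  simp only [e, tsum_mul_left]
  rw [((hs _).add (hs _)).tsum_add ((hs y).mul_left _), (hs _).tsum_add (hs _), tsum_mul_left]
  simp [greenAmp, rowAmp]

/-! ### The one-dimensional Green equations -/

/-- The equations satisfied by the real part `A` and the imaginary part `B` of the Green function,
seen from the row `o`, of the vertical walk with a complex potential of sign `ε`. -/
structure IsGreenPair (ε : ℤ → ℤ) (o : ℤ) (m κ τ : ℝ) (A B : ℤ → ℝ) : Prop where
  summable_re : Summable A
  summable_im : Summable B
  re_eq : ∀ y, m * A y + κ * (2 * A y - A (y - 1) - A (y + 1)) + τ * ε y * B y =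
    if y = o then 1 else 0
  im_eq : ∀ y, m * B y + κ * (2 * B y - B (y - 1) - B (y + 1)) = τ * ε y * A y

/-- Since `ε y` is a sign, the cosine does not see it and the sine is multiplied by it. The diagonal
coefficient 1 - (r/3) cos θ is the mass plus the 2r/3 absorbed by the Laplacian. -/
theorem isGreenPair_greenAmp {ε : ℤ → ℤ} (hε : ∀ y, ε y = 1 ∨ ε y = -1) (o : ℤ) {r : ℝ}
    (hr0 : 0 ≤ r) (hr1 : r < 1) (θ : ℝ) :
    IsGreenPair ε o (1 - r + r / 3 * (1 - Real.cos θ)) (r / 3) (r / 3 * Real.sin θ)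
      (fun y => (greenAmp ε o r θ y).re) (fun y => (greenAmp ε o r θ y).im) := by
  have hs := (summable_norm_greenAmp ε o hr0 hr1 θ)
  have hexp : ∀ y, Complex.exp ((ε y : ℂ) * θ * Complex.I) =
      ⟨Real.cos θ, ε y * Real.sin θ⟩ := by
    intro y
    rw [show (ε y : ℂ) * θ * Complex.I = ((ε y * θ : ℝ) : ℂ) * Complex.I by push_cast; ring]
    apply Complex.ext
    · rw [Complex.exp_ofReal_mul_I_re]; rcases hε y with h | h <;> simp [h]
    · rw [Complex.exp_ofReal_mul_I_im]; rcases hε y with h | h <;> simp [h]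
  have hre : ∀ y, (greenAmp ε o r θ y).re = (if y = o then 1 else 0) + r / 3 *
      ((greenAmp ε o r θ (y - 1)).re + (greenAmp ε o r θ (y + 1)).re +
        (Real.cos θ * (greenAmp ε o r θ y).re -
          ε y * Real.sin θ * (greenAmp ε o r θ y).im)) := by
    intro y
    have h := congrArg Complex.re (greenAmp_eq ε o hr0 hr1 θ y)
    rw [hexp, show (r : ℂ) / 3 = ((r / 3 : ℝ) : ℂ) by push_cast; rfl, Complex.add_re,
      Complex.re_ofReal_mul, Complex.add_re, Complex.add_re, Complex.mul_re] at h
    refine h.trans ?_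
    split_ifs <;> simp
  have him : ∀ y, (greenAmp ε o r θ y).im = r / 3 *
      ((greenAmp ε o r θ (y - 1)).im + (greenAmp ε o r θ (y + 1)).im +
        (Real.cos θ * (greenAmp ε o r θ y).im +
          ε y * Real.sin θ * (greenAmp ε o r θ y).re)) := by
    intro y
    have h := congrArg Complex.im (greenAmp_eq ε o hr0 hr1 θ y)
    rw [hexp, show (r : ℂ) / 3 = ((r / 3 : ℝ) : ℂ) by push_cast; rfl, Complex.add_im,
      Complex.im_ofReal_mul, Complex.add_im, Complex.add_im, Complex.mul_im] at h
    refine h.trans ?_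
    split_ifs <;> simp
  refine ⟨?_, ?_, fun y => ?_, fun y => ?_⟩
  · exact Summable.of_norm_bounded hs fun y => Complex.abs_re_le_norm _
  · exact Summable.of_norm_bounded hs fun y => Complex.abs_im_le_norm _
  · have := hre y; linear_combination this
  · have := him y; linear_combination this

theorem continuous_greenAmp (ε : ℤ → ℤ) (o : ℤ) {r : ℝ} (hr0 : 0 ≤ r) (hr1 : r < 1) (y : ℤ) :
    Continuous fun θ => greenAmp ε o r θ y := by
  unfold greenAmp
  refine continuous_tsum (u := fun n => r ^ n)
    (fun n => continuous_const.mul (continuous_rowAmp ε o n y))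
    (summable_geometric_of_lt_one hr0 hr1) fun n θ => ?_
  rw [norm_mul, norm_pow, Complex.norm_real, Real.norm_eq_abs, abs_of_nonneg hr0]
  exact mul_le_of_le_one_right (by positivity) (norm_rowAmp_le ε o θ n y)

/-- The generating function of the return probabilities as an integral over the frequencies. -/
theorem hasSum_stepProb (ε : ℤ → ℤ) (u : ℤ × ℤ) {r : ℝ} (hr0 : 0 ≤ r) (hr1 : r < 1) :
    HasSum (fun n => r ^ n * (2 * Real.pi * stepProb ε u n u))
      (∫ θ in -Real.pi..Real.pi, (greenAmp ε u.2 r θ u.2).re) := by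
  have h : HasSum (fun n => ∫ θ in -Real.pi..Real.pi, (r : ℂ) ^ n * rowAmp ε u.2 θ n u.2)
      (∫ θ in -Real.pi..Real.pi, greenAmp ε u.2 r θ u.2) := by
    refine intervalIntegral.hasSum_integral_of_dominated_convergence (fun n _ => r ^ n)
      (fun n => ?_) (fun n => ?_) ?_ ?_ ?_
    · exact (continuous_const.mul (continuous_rowAmp ε u.2 n u.2)).aestronglyMeasurable
    · refine Eventually.of_forall fun θ _ => ?_
      rw [norm_mul, norm_pow, Complex.norm_real, Real.norm_eq_abs, abs_of_nonneg hr0]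
      exact mul_le_of_le_one_right (by positivity) (norm_rowAmp_le ε u.2 θ n u.2)
    · exact Eventually.of_forall fun θ _ => summable_geometric_of_lt_one hr0 hr1
    · exact intervalIntegrable_const
    · exact Eventually.of_forall fun θ _ =>
        (summable_rowAmp_series ε u.2 hr0 hr1 θ u.2).hasSum
  have e : ∀ n, ∫ θ in -Real.pi..Real.pi, (r : ℂ) ^ n * rowAmp ε u.2 θ n u.2 =
      ((r ^ n * (2 * Real.pi * stepProb ε u n u) : ℝ) : ℂ) := by
    intro n
    have := integral_rowAmp ε u.1 u.2 n u.1 u.2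
    simp only [sub_self, Int.cast_zero, zero_mul, Complex.exp_zero, one_mul, Prod.mk.eta] at this
    rw [intervalIntegral.integral_const_mul, this]
    push_cast
    ring
  simp only [e] at h
  have h2 := Complex.hasSum_re h
  simp only [Complex.ofReal_re] at h2
  convert h2 using 1
  have := (Complex.reCLM.intervalIntegral_comp_comm
    ((continuous_greenAmp ε u.2 hr0 hr1 u.2).intervalIntegrable (μ := volume) (-Real.pi) Real.pi))
  simpa using this

/-! ### Summation by parts and energy estimates -/

theorem Summable.bounded_mul {φ u : ℤ → ℝ} {C : ℝ} (hφ : ∀ y, |φ y| ≤ C) (hu : Summable u) :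
    Summable fun y => φ y * u y := by
  refine Summable.of_norm_bounded (hu.norm.mul_left C) fun y => ?_
  rw [norm_mul]
  exact mul_le_mul_of_nonneg_right (hφ y) (norm_nonneg _)

theorem Summable.exists_abs_le {u : ℤ → ℝ} (hu : Summable u) : ∃ C, ∀ y, |u y| ≤ C :=
  ⟨∑' y, ‖u y‖, fun y => hu.norm.le_tsum y fun _ _ => norm_nonneg _⟩

theorem Summable.int_shift {u : ℤ → ℝ} (hu : Summable u) (a : ℤ) : Summable fun y => u (y + a) :=
  (Equiv.addRight a).summable_iff.2 hu

theorem tsum_int_shift (u : ℤ → ℝ) (a : ℤ) : ∑' y, u (y + a) = ∑' y, u y :=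
  (Equiv.addRight a).tsum_eq u

theorem Summable.sq_of_int {u : ℤ → ℝ} (hu : Summable u) : Summable fun y => u y ^ 2 := by
  obtain ⟨C, hC⟩ := hu.exists_abs_le
  simpa [sq] using Summable.bounded_mul hC hu

/-- Summation by parts for the discrete Laplacian. -/
theorem tsum_mul_laplacian {φ u : ℤ → ℝ} {C : ℝ} (hφ : ∀ y, |φ y| ≤ C) (hu : Summable u) :
    ∑' y, φ y * (2 * u y - u (y - 1) - u (y + 1)) =
      ∑' y, (φ (y + 1) - φ y) * (u (y + 1) - u y) := by
  have hu1 := hu.int_shift 1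
  have hd : Summable fun y => u (y + 1) - u y := hu1.sub hu
  have s1 := Summable.bounded_mul hφ hd
  have s2 := Summable.bounded_mul (fun y => hφ (y + 1)) hd
  have e1 : ∑' y, φ (y + 1) * (u (y + 1) - u y) = ∑' y, φ y * (u y - u (y - 1)) := by
    have := tsum_int_shift (fun y => φ y * (u y - u (y - 1))) 1
    simpa using this
  have s3 : Summable fun y => φ y * (u y - u (y - 1)) := by
    have := s2.int_shift (-1)
    simpa [sub_eq_add_neg] using this
  simp only [sub_mul (φ (_ + 1))]
  rw [s2.tsum_sub s1, e1, ← s3.tsum_sub s1]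
  exact tsum_congr fun y => by ring

namespace IsGreenPair

variable {ε : ℤ → ℤ} {o : ℤ} {m κ τ : ℝ} {A B : ℤ → ℝ}

/-- Since `A` and `B` are summable, bounded test functions are allowed: both the solution itself,
for the energy identity, and compactly supported tents. -/
theorem weak_re (h : IsGreenPair ε o m κ τ A B) (hε : ∀ y, |(ε y : ℝ)| ≤ 1) {φ : ℤ → ℝ} {C : ℝ}
    (hφ : ∀ y, |φ y| ≤ C) :
    m * ∑' y, φ y * A y + κ * ∑' y, (φ (y + 1) - φ y) * (A (y + 1) - A y) +
      τ * ∑' y, φ y * (ε y * B y) = φ o := by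
  have hA := h.summable_re
  have hAl : Summable fun y => 2 * A y - A (y - 1) - A (y + 1) := by
    simpa [sub_eq_add_neg] using ((hA.mul_left 2).sub (hA.int_shift (-1))).sub (hA.int_shift 1)
  have hεB := Summable.bounded_mul hε h.summable_im
  have s1 := (Summable.bounded_mul hφ hA).mul_left m
  have s2 := (Summable.bounded_mul hφ hAl).mul_left κ
  have s3 := (Summable.bounded_mul hφ hεB).mul_left τ
  rw [← tsum_mul_laplacian hφ hA, ← tsum_mul_left, ← tsum_mul_left, ← tsum_mul_left,
    ← s1.tsum_add s2, ← (s1.add s2).tsum_add s3]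
  have e : ∀ y, m * (φ y * A y) + κ * (φ y * (2 * A y - A (y - 1) - A (y + 1))) +
      τ * (φ y * (ε y * B y)) = if y = o then φ o else 0 := by
    intro y
    have := h.re_eq y
    split_ifs at this ⊢ with hy
    · subst hy; linear_combination φ y * this
    · linear_combination φ y * this
  rw [tsum_congr e, tsum_ite_eq]

theorem weak_im (h : IsGreenPair ε o m κ τ A B) {φ : ℤ → ℝ} {C : ℝ}
    (hφ : ∀ y, |φ y| ≤ C) :
    m * ∑' y, φ y * B y + κ * ∑' y, (φ (y + 1) - φ y) * (B (y + 1) - B y) =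
      τ * ∑' y, φ y * (ε y * A y) := by
  have hB := h.summable_im
  have hBl : Summable fun y => 2 * B y - B (y - 1) - B (y + 1) := by
    simpa [sub_eq_add_neg] using ((hB.mul_left 2).sub (hB.int_shift (-1))).sub (hB.int_shift 1)
  have s1 := (Summable.bounded_mul hφ hB).mul_left m
  have s2 := (Summable.bounded_mul hφ hBl).mul_left κ
  rw [← tsum_mul_laplacian hφ hB, ← tsum_mul_left, ← tsum_mul_left, ← tsum_mul_left,
    ← s1.tsum_add s2]
  refine tsum_congr fun y => ?_
  have := h.im_eq y
  linear_combination φ y * this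

/-- The energy identity. -/
theorem energy (h : IsGreenPair ε o m κ τ A B) (hε : ∀ y, |(ε y : ℝ)| ≤ 1) :
    (m * ∑' y, A y ^ 2 + κ * ∑' y, (A (y + 1) - A y) ^ 2) +
      (m * ∑' y, B y ^ 2 + κ * ∑' y, (B (y + 1) - B y) ^ 2) = A o := by
  obtain ⟨a, ha⟩ := h.summable_re.exists_abs_le
  obtain ⟨b, hb⟩ := h.summable_im.exists_abs_le
  have h1 := h.weak_re hε ha
  have h2 := h.weak_im hb
  -- The coupling terms of the two tested equations coincide, so they cancel when the equations are
  -- added.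
  have e : ∑' y, A y * (ε y * B y) = ∑' y, B y * (ε y * A y) := tsum_congr fun y => by ring
  rw [e] at h1
  simp only [sq]
  linarith

variable (h : IsGreenPair ε o m κ τ A B) (hε : ∀ y, |(ε y : ℝ)| ≤ 1) (hm : 0 < m) (hκ : 0 < κ)
include h hε hm hκ

theorem energy_bounds :
    m * ∑' y, A y ^ 2 ≤ A o ∧ κ * ∑' y, (A (y + 1) - A y) ^ 2 ≤ A o ∧
      m * ∑' y, B y ^ 2 + κ * ∑' y, (B (y + 1) - B y) ^ 2 ≤ A o := by
  have h0 := h.energy hε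
  have p1 : 0 ≤ m * ∑' y, A y ^ 2 := mul_nonneg hm.le (tsum_nonneg fun y => sq_nonneg _)
  have p2 : 0 ≤ κ * ∑' y, (A (y + 1) - A y) ^ 2 :=
    mul_nonneg hκ.le (tsum_nonneg fun y => sq_nonneg _)
  have p3 : 0 ≤ m * ∑' y, B y ^ 2 := mul_nonneg hm.le (tsum_nonneg fun y => sq_nonneg _)
  have p4 : 0 ≤ κ * ∑' y, (B (y + 1) - B y) ^ 2 :=
    mul_nonneg hκ.le (tsum_nonneg fun y => sq_nonneg _)
  exact ⟨by linarith, by linarith, by linarith⟩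

theorem nonneg : 0 ≤ A o :=
  (mul_nonneg hm.le (tsum_nonneg fun _ => sq_nonneg _)).trans (h.energy_bounds hε hm hκ).1

theorem mul_sum_sq_re_le (s : Finset ℤ) : m * ∑ y ∈ s, A y ^ 2 ≤ A o :=
  (mul_le_mul_of_nonneg_left (h.summable_re.sq_of_int.sum_le_tsum s fun _ _ => sq_nonneg _)
    hm.le).trans (h.energy_bounds hε hm hκ).1

theorem mul_sum_sq_re_diff_le (s : Finset ℤ) : κ * ∑ y ∈ s, (A (y + 1) - A y) ^ 2 ≤ A o :=
  (mul_le_mul_of_nonneg_left (((h.summable_re.int_shift 1).sub h.summable_re).sq_of_int.sum_le_tsum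
    s fun _ _ => sq_nonneg _) hκ.le).trans (h.energy_bounds hε hm hκ).2.1

theorem mul_sum_sq_im_le (s t : Finset ℤ) :
    m * ∑ y ∈ s, B y ^ 2 + κ * ∑ y ∈ t, (B (y + 1) - B y) ^ 2 ≤ A o :=
  (add_le_add (mul_le_mul_of_nonneg_left
    (h.summable_im.sq_of_int.sum_le_tsum s fun _ _ => sq_nonneg _) hm.le)
    (mul_le_mul_of_nonneg_left (((h.summable_im.int_shift 1).sub
      h.summable_im).sq_of_int.sum_le_tsum t fun _ _ => sq_nonneg _) hκ.le)).trans
    (h.energy_bounds hε hm hκ).2.2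

/-- Cauchy–Schwarz along the path from `s` to `s + n`, the gradient being controlled by the energy.
-/
theorem sq_sub_add_nat_le (s : ℤ) (n : ℕ) : κ * (A (s + n) - A s) ^ 2 ≤ n * A o := by
  have e : A (s + n) - A s = ∑ j ∈ Finset.range n, (A (s + j + 1) - A (s + j)) := by
    have := Finset.sum_range_sub (fun j : ℕ => A (s + j)) n
    simp only [Nat.cast_zero, add_zero, Nat.cast_add, Nat.cast_one, ← add_assoc] at this
    exact this.symm
  have h1 := sq_sum_le_card_mul_sum_sq (s := Finset.range n)
    (f := fun j : ℕ => A (s + j + 1) - A (s + j))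
  have h2 := h.mul_sum_sq_re_diff_le hε hm hκ ((Finset.range n).map
    ⟨fun j : ℕ => s + (j : ℤ), fun a b hab => by simpa using hab⟩)
  rw [Finset.sum_map] at h2
  change κ * ∑ j ∈ Finset.range n, (A (s + j + 1) - A (s + j)) ^ 2 ≤ A o at h2
  rw [← e, Finset.card_range] at h1
  calc κ * (A (s + n) - A s) ^ 2
      ≤ κ * (n * ∑ j ∈ Finset.range n, (A (s + j + 1) - A (s + j)) ^ 2) := by gcongr
    _ = n * (κ * ∑ j ∈ Finset.range n, (A (s + j + 1) - A (s + j)) ^ 2) := by ring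
    _ ≤ n * A o := by gcongr

theorem sq_sub_le (y : ℤ) : κ * (A y - A o) ^ 2 ≤ |(y - o : ℤ)| * A o := by
  rcases le_total o y with hy | hy
  · obtain ⟨n, rfl⟩ := Int.le.dest hy
    simpa using h.sq_sub_add_nat_le hε hm hκ o n
  · obtain ⟨n, hn⟩ := Int.le.dest hy
    have := h.sq_sub_add_nat_le hε hm hκ y n
    rw [hn] at this
    have e : |(y - o : ℤ)| = n := by rw [abs_of_nonpos (by omega)]; omega
    rw [e, ← neg_sub, neg_sq]
    exact_mod_cast this

/-- The previous Hölder bound makes the oscillation at most `A o / 2` within distance κ`A o`/4: a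
large peak is necessarily wide. -/
theorem half_le {y : ℤ} {R : ℝ} (hy : (|(y - o : ℤ)| : ℝ) ≤ R) (hR : 4 * R ≤ κ * A o) :
    A o / 2 ≤ A y := by
  have h1 := h.sq_sub_le hε hm hκ y
  have h0 := h.nonneg hε hm hκ
  rcases h0.eq_or_lt with h0 | h0
  · rw [← h0] at h1 ⊢
    have : (A y - 0) ^ 2 ≤ 0 := by
      rw [mul_zero] at h1
      by_contra hc
      push Not at hc
      exact absurd h1 (not_le.2 (mul_pos hκ hc))
    nlinarith
  · have h2 : κ * (A y - A o) ^ 2 ≤ κ * (A o / 2) ^ 2 := by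
      push_cast at h1 hy
      nlinarith
    have h3 := abs_le_of_sq_le_sq (le_of_mul_le_mul_left h2 hκ) (by positivity)
    linarith [(abs_le.1 h3).1]

/-- The peak keeps half its height on at least κ`A o`/4 sites, so its ℓ² mass is at least κ(`A
o`)³/16, whereas the energy allows at most `A o`/m. -/
theorem mul_mul_sq_le : m * κ * A o ^ 2 ≤ 16 := by
  have h0 := h.nonneg hε hm hκ
  rcases h0.eq_or_lt with h0 | h0
  · rw [← h0]; norm_num
  set n := ⌊κ * A o / 4⌋₊ with hn
  have hn1 : (n : ℝ) ≤ κ * A o / 4 := Nat.floor_le (by positivity)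
  have hn2 : κ * A o / 4 < n + 1 := Nat.lt_floor_add_one _
  have h1 := h.mul_sum_sq_re_le hε hm hκ ((Finset.range (n + 1)).map
    ⟨fun j : ℕ => o + (j : ℤ), fun a b hab => by simpa using hab⟩)
  rw [Finset.sum_map] at h1
  change m * ∑ j ∈ Finset.range (n + 1), A (o + j) ^ 2 ≤ A o at h1
  have h2 : ∑ j ∈ Finset.range (n + 1), (A o / 2) ^ 2 ≤
      ∑ j ∈ Finset.range (n + 1), A (o + j) ^ 2 := by
    refine Finset.sum_le_sum fun j hj => ?_
    have hj' : (j : ℝ) ≤ n := by exact_mod_cast Nat.lt_succ_iff.1 (Finset.mem_range.1 hj)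
    have := h.half_le hε hm hκ (y := o + j) (R := n) (by simpa using hj') (by linarith)
    gcongr
  rw [Finset.sum_const, Finset.card_range, nsmul_eq_mul] at h2
  push_cast at h2
  have h3 : m * (κ * A o / 4 * (A o / 2) ^ 2) ≤ A o :=
    (mul_le_mul_of_nonneg_left ((mul_le_mul_of_nonneg_right hn2.le (by positivity)).trans h2)
      hm.le).trans h1
  have h4 : A o * (m * κ * A o ^ 2) ≤ A o * 16 := by nlinarith
  exact le_of_mul_le_mul_left h4 h0

end IsGreenPair

/-! ### Upper bound from fluctuating partial sums, lower bound from a bounded primitive -/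

theorem sq_add_le_of_sq_le {m κ α β P Q X Y : ℝ} (hm : 0 ≤ m) (hκ : 0 ≤ κ) (hP : 0 ≤ P)
    (hQ : 0 ≤ Q) (hX : 0 ≤ X) (hY : 0 ≤ Y) (h1 : α ^ 2 ≤ P * X) (h2 : β ^ 2 ≤ Q * Y) :
    (m * α + κ * β) ^ 2 ≤ (m * P + κ * Q) * (m * X + κ * Y) := by
  have h3 : (α * β) ^ 2 ≤ ((P * Y + Q * X) / 2) ^ 2 := by
    have : (α * β) ^ 2 ≤ (P * X) * (Q * Y) := by
      rw [mul_pow]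
      exact mul_le_mul h1 h2 (sq_nonneg _) (by positivity)
    nlinarith [sq_nonneg (P * Y - Q * X)]
  have h4 := (abs_le.1 (abs_le_of_sq_le_sq h3 (by positivity))).2
  have h5 : m * κ * (α * β) ≤ m * κ * ((P * Y + Q * X) / 2) :=
    mul_le_mul_of_nonneg_left h4 (by positivity)
  have h6 : m ^ 2 * α ^ 2 ≤ m ^ 2 * (P * X) := mul_le_mul_of_nonneg_left h1 (by positivity)
  have h7 : κ ^ 2 * β ^ 2 ≤ κ ^ 2 * (Q * Y) := mul_le_mul_of_nonneg_left h2 (by positivity)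
  nlinarith

theorem sum_diff_mul_diff_eq (s : ℤ) (B : ℤ → ℝ) {H : ℕ → ℝ} (h0 : H 0 = 0) (n : ℕ) :
    ∑ j ∈ Finset.range n, (H (j + 1) - H j) * (B (s + j + 1) - B (s + j)) =
      H n * (B (s + n) - B (s + n - 1)) +
        ∑ j ∈ Finset.range n, H j * (2 * B (s + j) - B (s + j - 1) - B (s + j + 1)) := by
  induction n with
  | zero => simp [h0]
  | succ n ih =>
    rw [Finset.sum_range_succ, Finset.sum_range_succ, ih]
    have : s + ((n + 1 : ℕ) : ℤ) = s + n + 1 := by push_cast; ring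
    rw [this, add_sub_cancel_right]
    ring

/-- Summation by parts with `e` the backward difference of `D`; the boundary terms, including the
one with the unconstrained `e 0`, vanish with `w`. -/
theorem sum_mul_eq_neg_sum_diff (D w e : ℕ → ℝ) (hD : ∀ j, D (j + 1) - D j = e (j + 1))
    {n : ℕ} (h0 : w 0 = 0) (hn : w n = 0) :
    ∑ j ∈ Finset.range n, e j * w j = -∑ j ∈ Finset.range n, D j * (w (j + 1) - w j) := by
  have h1 := Finset.sum_range_sub (fun j => D j * w j) n
  have h2 : ∑ j ∈ Finset.range n, (D (j + 1) * w (j + 1) - D j * w j) =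
      ∑ j ∈ Finset.range n, D j * (w (j + 1) - w j) +
        ∑ j ∈ Finset.range n, e (j + 1) * w (j + 1) := by
    rw [← Finset.sum_add_distrib]
    refine Finset.sum_congr rfl fun j _ => ?_
    rw [← hD]; ring
  have h3 := Finset.sum_range_succ (fun j => e j * w j) n
  rw [Finset.sum_range_succ'] at h3
  simp only [h0, hn, mul_zero, add_zero, sub_zero] at h1 h3
  linarith

namespace IsGreenPair

variable {ε : ℤ → ℤ} {o : ℤ} {m κ τ : ℝ} {A B : ℤ → ℝ}
  (h : IsGreenPair ε o m κ τ A B) (hε : ∀ y, |(ε y : ℝ)| ≤ 1) (hm : 0 < m) (hκ : 0 < κ)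
include h hε hm hκ

/-- If the centred partial sums `D` of `ε` over a window of length `n` have a large `ℓ²` norm, then
the Green function at `o` is small. -/
theorem window_bound {s : ℤ} {n : ℕ} {D : ℕ → ℝ} (hD : ∀ j : ℕ, D (j + 1) - D j = ε (s + j + 1))
    (hsum : ∑ j ∈ Finset.range n, D j = 0) {R : ℝ} (hn : (n : ℝ) ≤ R)
    (hR : ∀ j ≤ n, (|(s + j - o : ℤ)| : ℝ) ≤ R) (hbig : 64 * R ≤ κ * A o) :
    τ ^ 2 * (∑ j ∈ Finset.range n, D j ^ 2) * A o ≤ 16 * (m * R ^ 2 + κ) := by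
  set T := ∑ j ∈ Finset.range n, D j ^ 2 with hT
  have hT0 : 0 ≤ T := Finset.sum_nonneg fun j _ => sq_nonneg _
  have hA0 := h.nonneg hε hm hκ
  have hR0 : 0 ≤ R := (Nat.cast_nonneg n).trans hn
  -- The test function is minus the primitive of `D`, a second primitive of ε up to sign. It
  -- vanishes at both ends because `D` is centred.
  set H : ℕ → ℝ := fun j => -∑ i ∈ Finset.range j, D i with hH
  have hH0 : H 0 = 0 := by simp [hH]
  have hHn : H n = 0 := by simp [hH, hsum]
  have hHd : ∀ j, H (j + 1) - H j = -D j := fun j => by simp [hH, Finset.sum_range_succ]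
  have hHle : ∀ j ∈ Finset.range n, H j ^ 2 ≤ R * T := by
    intro j hj
    have hj' := Finset.mem_range.1 hj
    have h1 := sq_sum_le_card_mul_sum_sq (s := Finset.range j) (f := D)
    rw [Finset.card_range] at h1
    have h2 : ∑ i ∈ Finset.range j, D i ^ 2 ≤ T :=
      Finset.sum_le_sum_of_subset_of_nonneg (Finset.range_mono hj'.le) fun i _ _ => sq_nonneg _
    have h3 : (j : ℝ) ≤ R := le_trans (by exact_mod_cast hj'.le) hn
    simp only [hH, neg_sq]
    exact h1.trans (mul_le_mul h3 h2 (Finset.sum_nonneg fun i _ => sq_nonneg _) hR0)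
  have hHsum : ∑ j ∈ Finset.range n, H j ^ 2 ≤ R ^ 2 * T := by
    calc _ ≤ ∑ j ∈ Finset.range n, R * T := Finset.sum_le_sum hHle
      _ = n * (R * T) := by simp
      _ ≤ R * (R * T) := by gcongr
      _ = _ := by ring
  set emb : ℕ ↪ ℤ := ⟨fun j : ℕ => s + (j : ℤ), fun a b hab => by simpa using hab⟩
  have hda := h.mul_sum_sq_re_diff_le hε hm hκ ((Finset.range n).map emb)
  have hdb := h.mul_sum_sq_im_le hε hm hκ ((Finset.range n).map emb) ((Finset.range n).map emb)
  rw [Finset.sum_map] at hda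
  rw [Finset.sum_map, Finset.sum_map] at hdb
  change κ * ∑ j ∈ Finset.range n, (A (s + j + 1) - A (s + j)) ^ 2 ≤ A o at hda
  change m * ∑ j ∈ Finset.range n, B (s + j) ^ 2 +
    κ * ∑ j ∈ Finset.range n, (B (s + j + 1) - B (s + j)) ^ 2 ≤ A o at hdb
  -- The imaginary equation tested against `H`; the vanishing ends leave no boundary term.
  have hmain : τ * ∑ j ∈ Finset.range n, ε (s + j) * (H j * A (s + j)) =
      m * ∑ j ∈ Finset.range n, H j * B (s + j) +
        κ * ∑ j ∈ Finset.range n, (H (j + 1) - H j) * (B (s + j + 1) - B (s + j)) := by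
    rw [sum_diff_mul_diff_eq s B hH0, hHn, zero_mul, zero_add, Finset.mul_sum, Finset.mul_sum,
      Finset.mul_sum, ← Finset.sum_add_distrib]
    refine Finset.sum_congr rfl fun j _ => ?_
    have := h.im_eq (s + j)
    linear_combination -H j * this
  -- Moving the difference off `D` produces Σ D²A, at least T(`A o`)/2 because `A` stays above half
  -- its peak, and an error Σ DH∇A, at most T(`A o`)/8 by the energy and `hbig`.
  have hlow : T * A o / 4 ≤ ∑ j ∈ Finset.range n, ε (s + j) * (H j * A (s + j)) := by
    have e1 := sum_mul_eq_neg_sum_diff D (fun j => H j * A (s + j)) (fun j => ε (s + j))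
      (fun j => by rw [hD]; push_cast; rw [add_assoc]) (n := n) (by simp [hH0]) (by simp [hHn])
    have e2 : ∑ j ∈ Finset.range n, D j *
        (H (j + 1) * A (s + (j + 1 : ℕ)) - H j * A (s + j)) =
        ∑ j ∈ Finset.range n, D j * (H j * (A (s + j + 1) - A (s + j))) -
        ∑ j ∈ Finset.range n, D j ^ 2 * A (s + j + 1) := by
      rw [← Finset.sum_sub_distrib]
      refine Finset.sum_congr rfl fun j _ => ?_
      have := hHd j
      push_cast
      rw [← add_assoc]
      linear_combination D j * A (s + j + 1) * this
    rw [e1, e2]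
    have l1 : T * (A o / 2) ≤ ∑ j ∈ Finset.range n, D j ^ 2 * A (s + j + 1) := by
      rw [hT, Finset.sum_mul]
      refine Finset.sum_le_sum fun j hj => mul_le_mul_of_nonneg_left ?_ (sq_nonneg _)
      have := hR (j + 1) (Finset.mem_range.1 hj)
      refine h.half_le hε hm hκ (R := R) ?_ (by linarith)
      push_cast at this ⊢
      rwa [add_assoc]
    have l2 : (∑ j ∈ Finset.range n, D j * (H j * (A (s + j + 1) - A (s + j)))) ^ 2 ≤
        (T * A o / 8) ^ 2 := by
      refine (Finset.sum_mul_sq_le_sq_mul_sq _ _ _).trans ?_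
      have : ∑ j ∈ Finset.range n, (H j * (A (s + j + 1) - A (s + j))) ^ 2 ≤
          R * T * ∑ j ∈ Finset.range n, (A (s + j + 1) - A (s + j)) ^ 2 := by
        rw [Finset.mul_sum]
        refine Finset.sum_le_sum fun j hj => ?_
        rw [mul_pow]
        exact mul_le_mul_of_nonneg_right (hHle j hj) (sq_nonneg _)
      set Z := ∑ j ∈ Finset.range n, (A (s + j + 1) - A (s + j)) ^ 2
      have hZ : 0 ≤ Z := Finset.sum_nonneg fun j _ => sq_nonneg _
      have hRZ : 64 * (R * Z) ≤ A o ^ 2 := by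
        have h1 : 64 * R * Z ≤ κ * A o * Z := mul_le_mul_of_nonneg_right hbig hZ
        have h2 : A o * (κ * Z) ≤ A o * A o := mul_le_mul_of_nonneg_left hda hA0
        nlinarith
      calc T * ∑ j ∈ Finset.range n, (H j * (A (s + j + 1) - A (s + j))) ^ 2
          ≤ T * (R * T * Z) := mul_le_mul_of_nonneg_left this hT0
        _ = T ^ 2 * (R * Z) := by ring
        _ ≤ T ^ 2 * (A o ^ 2 / 64) := by gcongr; linarith
        _ = _ := by ring
    have l3 := (abs_le.1 (abs_le_of_sq_le_sq l2 (by positivity))).2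
    nlinarith [mul_nonneg hT0 hA0]
  -- Cauchy–Schwarz against the energy of `B`, with ‖H‖² ≤ R²T and ‖∇H‖² = T.
  have hup : (τ * ∑ j ∈ Finset.range n, ε (s + j) * (H j * A (s + j))) ^ 2 ≤
      (m * (R ^ 2 * T) + κ * T) * A o := by
    rw [hmain]
    have c1 := Finset.sum_mul_sq_le_sq_mul_sq (Finset.range n) H fun j => B (s + j)
    have c2 := Finset.sum_mul_sq_le_sq_mul_sq (Finset.range n) (fun j => H (j + 1) - H j)
      fun j => B (s + j + 1) - B (s + j)
    refine (sq_add_le_of_sq_le hm.le hκ.le ?_ ?_ ?_ ?_ c1 c2).trans ?_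
    any_goals exact Finset.sum_nonneg fun j _ => sq_nonneg _
    have e3 : ∑ j ∈ Finset.range n, (H (j + 1) - H j) ^ 2 = T :=
      Finset.sum_congr rfl fun j _ => by rw [hHd, neg_sq]
    rw [e3]
    exact mul_le_mul (by gcongr) hdb (add_nonneg
      (mul_nonneg hm.le (Finset.sum_nonneg fun j _ => sq_nonneg _))
      (mul_nonneg hκ.le (Finset.sum_nonneg fun j _ => sq_nonneg _))) (by positivity)
  have hfin : τ ^ 2 * (T * A o / 4) ^ 2 ≤ (m * (R ^ 2 * T) + κ * T) * A o := by
    refine le_trans ?_ hup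
    rw [mul_pow]
    gcongr
  rcases (mul_nonneg hT0 hA0).eq_or_lt with h0 | h0
  · rw [mul_assoc, ← h0, mul_zero]
    positivity
  · have : (T * A o) * (τ ^ 2 * T * A o) ≤ (T * A o) * (16 * (m * R ^ 2 + κ)) := by nlinarith
    exact le_of_mul_le_mul_left this h0

/-- If `ε` has a bounded primitive, then the Green function at `o` is large. -/
theorem bounded_primitive_bound {F : ℤ → ℝ} {C : ℝ} (hF : ∀ y, F (y + 1) - F y = ε y)
    (hFC : ∀ y, |F y| ≤ C) {N : ℕ} (hN : 0 < N) :
    1 ≤ 12 * A o * (m * N + κ / N + τ ^ 2 * C ^ 2 * (1 / (N * m) + N / κ)) := by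
  have hN' : (0 : ℝ) < N := by exact_mod_cast hN
  have hC0 : 0 ≤ C := (abs_nonneg _).trans (hFC 0)
  have hA0 := h.nonneg hε hm hκ
  -- A tent of height 1 at `o` and half-width `N`, with slopes at most 1/N.
  set u : ℤ → ℝ := fun y => max (1 - |((y - o : ℤ) : ℝ)| / N) 0 with hu
  have hu0 : ∀ y, 0 ≤ u y := fun y => le_max_right _ _
  have hu1 : ∀ y, u y ≤ 1 := fun y => max_le (by
    have : 0 ≤ |((y - o : ℤ) : ℝ)| / N := by positivity
    linarith) zero_le_one
  have huabs : ∀ y, |u y| ≤ 1 := fun y => by rw [abs_of_nonneg (hu0 y)]; exact hu1 y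
  have huo : u o = 1 := by simp [hu]
  have hud : ∀ y, |u (y + 1) - u y| ≤ 1 / N := by
    intro y
    refine (abs_max_sub_max_le_abs _ _ 0).trans ?_
    have e : (1 - |((y + 1 - o : ℤ) : ℝ)| / N) - (1 - |((y - o : ℤ) : ℝ)| / N) =
        (|((y - o : ℤ) : ℝ)| - |((y + 1 - o : ℤ) : ℝ)|) / N := by ring
    rw [e, abs_div, abs_of_pos hN']
    gcongr
    refine (abs_abs_sub_abs_le_abs_sub _ _).trans ?_
    push_cast
    rw [show (y : ℝ) - o - (y + 1 - o) = -1 by ring]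
    simp
  set S := Finset.Icc (o - N) (o + N) with hS
  have huz : ∀ y, (N : ℤ) ≤ |y - o| → u y = 0 := by
    intro y hy
    have hy' : (N : ℝ) ≤ |((y - o : ℤ) : ℝ)| := by exact_mod_cast hy
    refine max_eq_right ?_
    have : 1 ≤ |((y - o : ℤ) : ℝ)| / N := by rwa [le_div_iff₀ hN', one_mul]
    linarith
  have huS : ∀ y ∉ S, u y = 0 := by
    intro y hy
    refine huz y ?_
    simp only [hS, Finset.mem_Icc, not_and_or, not_le] at hy
    rw [le_abs]
    omega
  have hudS : ∀ y ∉ S, u (y + 1) - u y = 0 := by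
    intro y hy
    rw [huS y hy, huz (y + 1), sub_zero]
    simp only [hS, Finset.mem_Icc, not_and_or, not_le] at hy
    rw [le_abs]
    omega
  have hcard : (S.card : ℝ) ≤ 3 * N := by
    have : S.card = 2 * N + 1 := by rw [hS, Int.card_Icc]; omega
    rw [this]
    have : (1 : ℝ) ≤ N := by exact_mod_cast hN
    push_cast
    linarith
  have hsumle : ∀ (φ : ℤ → ℝ) (b : ℝ), (∀ y, |φ y| ≤ b) → ∑ y ∈ S, φ y ^ 2 ≤ 3 * N * b ^ 2 := by
    intro φ b hφ
    calc ∑ y ∈ S, φ y ^ 2 ≤ ∑ y ∈ S, b ^ 2 := Finset.sum_le_sum fun y _ => by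
          rw [← sq_abs]; exact pow_le_pow_left₀ (abs_nonneg _) (hφ y) 2
      _ = S.card * b ^ 2 := by simp
      _ ≤ _ := by gcongr
  have hweak := h.weak_re hε huabs
  rw [huo, tsum_eq_sum (s := S) fun y hy => by rw [huS y hy, zero_mul],
    tsum_eq_sum (s := S) fun y hy => by rw [hudS y hy, zero_mul]] at hweak
  have hw : Summable fun y => u y * B y := Summable.bounded_mul huabs h.summable_im
  -- Replacing ε by the difference of `F` and summing by parts leaves only differences of `u` and of
  -- `B`, with bounded coefficients.
  have hparts : ∑' y, u y * (ε y * B y) =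
      -(∑ y ∈ S, F (y + 1) * (u (y + 1) - u y) * B (y + 1) +
        ∑ y ∈ S, F (y + 1) * u y * (B (y + 1) - B y)) := by
    have s1 := Summable.bounded_mul hFC hw
    have s2 := Summable.bounded_mul (fun y => hFC (y + 1)) hw
    have s3 := s1.int_shift 1
    have e1 : ∑' y, u y * (ε y * B y) =
        ∑' y, F (y + 1) * (u y * B y) - ∑' y, F y * (u y * B y) := by
      rw [← s2.tsum_sub s1]
      exact tsum_congr fun y => by rw [← hF]; ring
    rw [e1, ← tsum_int_shift (fun y => F y * (u y * B y)) 1, ← s2.tsum_sub s3,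
      tsum_eq_sum (s := S) fun y hy => ?_, ← Finset.sum_add_distrib, ← Finset.sum_neg_distrib]
    · exact Finset.sum_congr rfl fun y _ => by ring
    · have h1 := huS y hy
      have h2 := hudS y hy
      rw [h1, sub_zero] at h2
      rw [h1, h2]
      ring
  rw [hparts] at hweak
  have hFu' : ∀ y, |F (y + 1) * (u (y + 1) - u y)| ≤ C * (1 / N) := fun y => by
    rw [abs_mul]; exact mul_le_mul (hFC _) (hud y) (abs_nonneg _) hC0
  have hFu : ∀ y, |F (y + 1) * u y| ≤ C * 1 := fun y => by
    rw [abs_mul]; exact mul_le_mul (hFC _) (huabs y) (abs_nonneg _) hC0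
  have c1 := (Finset.sum_mul_sq_le_sq_mul_sq S u A).trans (mul_le_mul_of_nonneg_right
    (hsumle u 1 huabs) (Finset.sum_nonneg fun y _ => sq_nonneg _))
  have c2 := (Finset.sum_mul_sq_le_sq_mul_sq S (fun y => u (y + 1) - u y)
    fun y => A (y + 1) - A y).trans (mul_le_mul_of_nonneg_right
    (hsumle _ _ hud) (Finset.sum_nonneg fun y _ => sq_nonneg _))
  have c3 := (Finset.sum_mul_sq_le_sq_mul_sq S (fun y => F (y + 1) * (u (y + 1) - u y))
    fun y => B (y + 1)).trans (mul_le_mul_of_nonneg_right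
    (hsumle _ _ hFu') (Finset.sum_nonneg fun y _ => sq_nonneg _))
  have c4 := (Finset.sum_mul_sq_le_sq_mul_sq S (fun y => F (y + 1) * u y)
    fun y => B (y + 1) - B y).trans (mul_le_mul_of_nonneg_right
    (hsumle _ _ hFu) (Finset.sum_nonneg fun y _ => sq_nonneg _))
  have d1 := h.mul_sum_sq_re_le hε hm hκ S
  have d2 := h.mul_sum_sq_re_diff_le hε hm hκ S
  have d3 := h.mul_sum_sq_im_le hε hm hκ (S.map (addRightEmbedding 1)) ∅
  have d4 := h.mul_sum_sq_im_le hε hm hκ ∅ S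
  rw [Finset.sum_map] at d3
  simp only [Finset.sum_empty, mul_zero, add_zero, zero_add, addRightEmbedding_apply] at d3 d4
  set X1 := ∑ y ∈ S, u y * A y
  set X2 := ∑ y ∈ S, (u (y + 1) - u y) * (A (y + 1) - A y)
  set X3 := ∑ y ∈ S, F (y + 1) * (u (y + 1) - u y) * B (y + 1)
  set X4 := ∑ y ∈ S, F (y + 1) * u y * (B (y + 1) - B y)
  set Z1 := ∑ y ∈ S, A y ^ 2
  set Z2 := ∑ y ∈ S, (A (y + 1) - A y) ^ 2
  set Z3 := ∑ y ∈ S, B (y + 1) ^ 2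
  set Z4 := ∑ y ∈ S, (B (y + 1) - B y) ^ 2
  have k1 : (m * X1) ^ 2 ≤ 3 * A o * (m * N) := by
    calc (m * X1) ^ 2 = m ^ 2 * X1 ^ 2 := by ring
      _ ≤ m ^ 2 * (3 * N * 1 ^ 2 * Z1) := by gcongr
      _ = 3 * N * m * (m * Z1) := by ring
      _ ≤ 3 * N * m * A o := by gcongr
      _ = _ := by ring
  have k2 : (κ * X2) ^ 2 ≤ 3 * A o * (κ / N) := by
    calc (κ * X2) ^ 2 = κ ^ 2 * X2 ^ 2 := by ring
      _ ≤ κ ^ 2 * (3 * N * (1 / N) ^ 2 * Z2) := by gcongr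
      _ = 3 * (κ / N) * (κ * Z2) := by field_simp
      _ ≤ 3 * (κ / N) * A o := by gcongr
      _ = _ := by ring
  have k3 : (τ * X3) ^ 2 ≤ 3 * A o * (τ ^ 2 * C ^ 2 * (1 / (N * m))) := by
    calc (τ * X3) ^ 2 = τ ^ 2 * X3 ^ 2 := by ring
      _ ≤ τ ^ 2 * (3 * N * (C * (1 / N)) ^ 2 * Z3) := by gcongr
      _ = 3 * (τ ^ 2 * C ^ 2 * (1 / (N * m))) * (m * Z3) := by field_simp
      _ ≤ 3 * (τ ^ 2 * C ^ 2 * (1 / (N * m))) * A o := by gcongr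
      _ = _ := by ring
  have k4 : (τ * X4) ^ 2 ≤ 3 * A o * (τ ^ 2 * C ^ 2 * (N / κ)) := by
    calc (τ * X4) ^ 2 = τ ^ 2 * X4 ^ 2 := by ring
      _ ≤ τ ^ 2 * (3 * N * (C * 1) ^ 2 * Z4) := by gcongr
      _ = 3 * (τ ^ 2 * C ^ 2 * (N / κ)) * (κ * Z4) := by field_simp
      _ ≤ 3 * (τ ^ 2 * C ^ 2 * (N / κ)) * A o := by gcongr
      _ = _ := by ring
  -- The tested equation writes 1 as a sum of four terms. The factor 4 from squaring and the factor
  -- 3 from the support size of at most 3N give the 12.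
  have hone : (1 : ℝ) ≤ 4 * ((m * X1) ^ 2 + (κ * X2) ^ 2 + (τ * X3) ^ 2 + (τ * X4) ^ 2) := by
    have e : 1 = m * X1 + κ * X2 - τ * X3 - τ * X4 := by linarith
    generalize m * X1 = a at e ⊢
    generalize κ * X2 = b at e ⊢
    generalize τ * X3 = c at e ⊢
    generalize τ * X4 = d at e ⊢
    have e2 : (1 : ℝ) = (a + b - c - d) ^ 2 := by rw [← e]; norm_num
    rw [e2]
    nlinarith [sq_nonneg (a - b), sq_nonneg (a + c), sq_nonneg (a + d), sq_nonneg (b + c),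
      sq_nonneg (b + d), sq_nonneg (c - d)]
  linarith

end IsGreenPair

/-! ### Recurrence from a bounded primitive -/

theorem abs_intCast_le_one_of_sign {ε : ℤ → ℤ} (hε : ∀ y, ε y = 1 ∨ ε y = -1) (y : ℤ) :
    |(ε y : ℝ)| ≤ 1 := by
  rcases hε y with h | h <;> simp [h]

theorem sq_div_le_one_sub_cos {θ : ℝ} (hθ : |θ| ≤ Real.pi) : θ ^ 2 / 5 ≤ 1 - Real.cos θ := by
  have h1 := Real.cos_le_one_sub_mul_cos_sq hθ
  have h2 : (1 : ℝ) / 5 ≤ 2 / Real.pi ^ 2 := by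
    rw [div_le_div_iff₀ (by norm_num) (by positivity)]
    nlinarith [Real.pi_lt_d2, Real.pi_pos]
  nlinarith [sq_nonneg θ]

theorem sq_le_ten_mul_sin_sq {θ : ℝ} (hθ : |θ| ≤ 1) : θ ^ 2 ≤ 10 * (Real.sin θ) ^ 2 := by
  have h1 := Real.mul_abs_le_abs_sin (x := θ) (hθ.trans (by linarith [Real.pi_gt_three]))
  have h2 : (1 : ℝ) / 2 ≤ 2 / Real.pi := by
    rw [div_le_div_iff₀ (by norm_num) Real.pi_pos]
    linarith [Real.pi_le_four]
  have h3 : 1 / 2 * |θ| ≤ |Real.sin θ| :=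
    (mul_le_mul_of_nonneg_right h2 (abs_nonneg _)).trans h1
  rw [← sq_abs θ, ← sq_abs (Real.sin θ)]
  nlinarith [abs_nonneg θ]

theorem greenAmp_mass_pos {r : ℝ} (hr0 : 0 ≤ r) (hr1 : r < 1) (θ : ℝ) :
    0 < 1 - r + r / 3 * (1 - Real.cos θ) := by
  have := mul_nonneg (by linarith : (0 : ℝ) ≤ r / 3) (sub_nonneg.2 (Real.cos_le_one θ))
  linarith

theorem greenAmp_re_nonneg {ε : ℤ → ℤ} (hε : ∀ y, ε y = 1 ∨ ε y = -1) (o : ℤ) {r : ℝ}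
    (hr0 : 0 < r) (hr1 : r < 1) (θ : ℝ) : 0 ≤ (greenAmp ε o r θ o).re :=
  (isGreenPair_greenAmp hε o hr0.le hr1 θ).nonneg (abs_intCast_le_one_of_sign hε)
    (greenAmp_mass_pos hr0.le hr1 θ) (by linarith)

theorem greenAmp_lower_bound {ε : ℤ → ℤ} (hε : ∀ y, ε y = 1 ∨ ε y = -1) (o : ℤ) {F : ℤ → ℝ}
    {C : ℝ} (hF : ∀ y, F (y + 1) - F y = ε y) (hFC : ∀ y, |F y| ≤ C) {r θ : ℝ} (hr : 1 / 2 ≤ r)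
    (hr1 : r < 1) (hθ0 : 0 < θ) (hθ1 : θ ≤ 1) (hrθ : 1 - r ≤ θ ^ 2) :
    1 ≤ 72 * (1 + C ^ 2) * θ * (greenAmp ε o r θ o).re := by
  have hG := isGreenPair_greenAmp hε o (by linarith : 0 ≤ r) hr1 θ
  have hm := greenAmp_mass_pos (by linarith : 0 ≤ r) hr1 θ
  have hA := greenAmp_re_nonneg hε o (by linarith : 0 < r) hr1 θ
  have hκ : 0 < r / 3 := by linarith
  -- This width balances the errors: with m of order θ² and τ at most of order θ, each of the four
  -- is at most of order θ.
  set N := ⌈1 / θ⌉₊ with hN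
  have hN1 : 1 / θ ≤ N := Nat.le_ceil _
  have hN0 : 0 < N := Nat.ceil_pos.2 (by positivity)
  have hN2 : (N : ℝ) ≤ 2 / θ := by
    have h1 := Nat.ceil_lt_add_one (a := 1 / θ) (by positivity)
    have h2 : 1 ≤ 1 / θ := by rw [le_div_iff₀ hθ0]; linarith
    have h3 : 2 / θ = 1 / θ + 1 / θ := by ring
    linarith
  have hN' : (0 : ℝ) < N := by exact_mod_cast hN0
  have hb := hG.bounded_primitive_bound (abs_intCast_le_one_of_sign hε) hm hκ hF hFC hN0
  set m := 1 - r + r / 3 * (1 - Real.cos θ) with hmdef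
  have hcos1 := sq_div_le_one_sub_cos (θ := θ)
    (by rw [abs_of_pos hθ0]; linarith [Real.pi_gt_three])
  have hcos2 := Real.one_sub_sq_div_two_le_cos (x := θ)
  have hm1 : θ ^ 2 / 30 ≤ m := by
    have : r / 3 * (θ ^ 2 / 5) ≤ r / 3 * (1 - Real.cos θ) := by gcongr
    nlinarith [sq_nonneg θ]
  have hm2 : m ≤ 2 * θ ^ 2 := by
    have : r / 3 * (1 - Real.cos θ) ≤ r / 3 * (θ ^ 2 / 2) := by gcongr; linarith
    nlinarith [sq_nonneg θ]
  have hsin : (r / 3 * Real.sin θ) ^ 2 ≤ θ ^ 2 / 9 := by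
    have h1 : Real.sin θ ^ 2 ≤ θ ^ 2 := Real.sin_sq_le_sq
    have h2 : (r / 3) ^ 2 ≤ (1 / 3) ^ 2 := by gcongr
    rw [mul_pow]
    calc _ ≤ (1 / 3) ^ 2 * θ ^ 2 := by gcongr
      _ = _ := by ring
  have t1 : m * N ≤ 4 * θ := by
    calc m * N ≤ 2 * θ ^ 2 * (2 / θ) := by gcongr
      _ = 4 * θ := by field_simp; norm_num
  have t2 : r / 3 / N ≤ θ := by
    rw [div_le_iff₀ hN']
    have : 1 ≤ θ * N := by rw [div_le_iff₀ hθ0] at hN1; linarith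
    linarith
  have t3 : θ ^ 2 / 9 * (1 / (N * m)) ≤ 4 * θ := by
    calc θ ^ 2 / 9 * (1 / (N * m)) ≤ θ ^ 2 / 9 * (1 / (1 / θ * (θ ^ 2 / 30))) := by gcongr
      _ = 30 / 9 * θ := by field_simp
      _ ≤ 4 * θ := by linarith
  have t4 : θ ^ 2 / 9 * (N / (r / 3)) ≤ 2 * θ := by
    have : (1 : ℝ) / 6 ≤ r / 3 := by linarith
    calc θ ^ 2 / 9 * (N / (r / 3)) ≤ θ ^ 2 / 9 * (2 / θ / (1 / 6)) := by gcongr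
      _ = 12 / 9 * θ := by field_simp; norm_num
      _ ≤ _ := by linarith
  have t5 : (r / 3 * Real.sin θ) ^ 2 * C ^ 2 * (1 / (N * m) + N / (r / 3)) ≤ C ^ 2 * (6 * θ) := by
    calc _ ≤ θ ^ 2 / 9 * C ^ 2 * (1 / (N * m) + N / (r / 3)) := by gcongr
      _ = C ^ 2 * (θ ^ 2 / 9 * (1 / (N * m)) + θ ^ 2 / 9 * (N / (r / 3))) := by ring
      _ ≤ _ := by gcongr; linarith
  calc (1 : ℝ) ≤ _ := hb
    _ ≤ 12 * (greenAmp ε o r θ o).re * (4 * θ + θ + C ^ 2 * (6 * θ)) := by gcongr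
    _ ≤ _ := by nlinarith [mul_nonneg hA hθ0.le]

theorem walkRecurrent_of_bounded_primitive {ε : ℤ → ℤ} (hε : ∀ y, ε y = 1 ∨ ε y = -1) {F : ℤ → ℝ}
    {C : ℝ} (hF : ∀ y, F (y + 1) - F y = ε y) (hFC : ∀ y, |F y| ≤ C) : WalkRecurrent ε := by
  intro u
  by_contra hne
  have hsum := (returnProb_lt_one_iff_summable ε u).1 (lt_of_le_of_ne (returnProb_le_one ε u) hne)
  set K := 2 * Real.pi * ∑' n, stepProb ε u n u with hK
  set c := 72 * (1 + C ^ 2) with hc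
  have hc0 : 0 < c := by positivity
  -- The integral of 1/(cθ) over [ρ, 1] is `x / c`, which exceeds the bound `K` that summability
  -- would impose. Taking r = 1 - ρ² keeps 1 - r ≤ θ² on this interval.
  set x := max 1 (c * K + 1) with hx
  set ρ := Real.exp (-x) with hρ
  have hρ0 : 0 < ρ := Real.exp_pos _
  have hρ1 : ρ ≤ 1 / 2 := by
    have h1 : ρ ≤ Real.exp (-1) := Real.exp_le_exp.2 (neg_le_neg (le_max_left _ _))
    have := Real.exp_neg_one_lt_d9
    linarith
  set r := 1 - ρ ^ 2 with hr
  have hr0 : 1 / 2 ≤ r := by nlinarith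
  have hr1 : r < 1 := by have := pow_pos hρ0 2; linarith
  have hS := hasSum_stepProb ε u (by linarith : 0 ≤ r) hr1
  have hup : ∫ θ in -Real.pi..Real.pi, (greenAmp ε u.2 r θ u.2).re ≤ K := by
    rw [hK, ← tsum_mul_left]
    refine hasSum_le (fun n => ?_) hS (hsum.mul_left (2 * Real.pi)).hasSum
    exact mul_le_of_le_one_left (mul_nonneg (by positivity) (stepProb_nonneg ε u n u))
      (pow_le_one₀ (by linarith) hr1.le)
  have hcont : Continuous fun θ => (greenAmp ε u.2 r θ u.2).re :=
    Complex.continuous_re.comp (continuous_greenAmp ε u.2 (by linarith : 0 ≤ r) hr1 u.2)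
  have hpi := Real.pi_gt_three
  have hlow : ∫ θ in ρ..1, c⁻¹ * θ⁻¹ ≤ ∫ θ in -Real.pi..Real.pi, (greenAmp ε u.2 r θ u.2).re := by
    refine le_trans ?_ (intervalIntegral.integral_mono_interval (c := -Real.pi) (d := Real.pi)
      (a := ρ) (b := 1) (by linarith) (by linarith) (by linarith)
      (Eventually.of_forall fun θ => greenAmp_re_nonneg hε u.2 (by linarith) hr1 θ)
      (hcont.intervalIntegrable _ _))
    refine intervalIntegral.integral_mono_on (by linarith) ?_ (hcont.intervalIntegrable _ _) ?_
    · refine (ContinuousOn.intervalIntegrable ?_)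
      refine continuousOn_const.mul (continuousOn_inv₀.mono ?_)
      intro θ hθ
      rw [Set.uIcc_of_le (by linarith)] at hθ
      exact (lt_of_lt_of_le hρ0 hθ.1).ne'
    · intro θ hθ
      have hθ0 : 0 < θ := lt_of_lt_of_le hρ0 hθ.1
      have := greenAmp_lower_bound hε u.2 hF hFC hr0 hr1 hθ0 hθ.2
        (by rw [hr]; have := pow_le_pow_left₀ hρ0.le hθ.1 2; linarith)
      rw [← mul_inv, inv_le_iff_one_le_mul₀ (by positivity)]
      linarith
  rw [intervalIntegral.integral_const_mul, integral_inv_of_pos hρ0 one_pos, one_div, Real.log_inv,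
    hρ, Real.log_exp, neg_neg] at hlow
  have h1 : c⁻¹ * x ≤ K := hlow.trans hup
  rw [inv_mul_le_iff₀ hc0] at h1
  have := le_max_right 1 (c * K + 1)
  linarith

/-! ### Transience from spread windows -/

/-- A crude bound from the mass alone, used away from θ = 0, where m is bounded below, and for |θ| ≤
√(1 - r), where m ≥ 1 - r. -/
theorem greenAmp_sq_le {ε : ℤ → ℤ} (hε : ∀ y, ε y = 1 ∨ ε y = -1) (o : ℤ) {r θ b : ℝ}
    (hr : 1 / 2 ≤ r) (hr1 : r < 1) (hb : b ≤ 1 - r + r / 3 * (1 - Real.cos θ)) :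
    b * (greenAmp ε o r θ o).re ^ 2 ≤ 96 := by
  have hG := isGreenPair_greenAmp hε o (by linarith : 0 ≤ r) hr1 θ
  have hm := greenAmp_mass_pos (by linarith : 0 ≤ r) hr1 θ
  have h1 := hG.mul_mul_sq_le (abs_intCast_le_one_of_sign hε) hm (by linarith : 0 < r / 3)
  set m := 1 - r + r / 3 * (1 - Real.cos θ)
  set a := (greenAmp ε o r θ o).re
  have h2 : b * a ^ 2 ≤ m * a ^ 2 := by gcongr
  have hκ : (1 : ℝ) / 6 ≤ r / 3 := by linarith
  have h3 : m * (1 / 6) * a ^ 2 ≤ m * (r / 3) * a ^ 2 := by gcongr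
  linarith

/-- `HasSpreadWindows ε δ k₀`: for every `k ≥ k₀`, the centred partial sums of `ε` over the window
`(2 ^ k, 3 * 2 ^ k]` have a squared `ℓ²` norm of at least `2 ^ (k * (1 + δ))`. -/
def HasSpreadWindows (ε : ℤ → ℤ) (δ : ℝ) (k₀ : ℕ) : Prop :=
  ∀ k ≥ k₀, ∃ D : ℕ → ℝ, (∀ j : ℕ, D (j + 1) - D j = ε (2 ^ k + j + 1)) ∧
    ∑ j ∈ Finset.range (2 * 2 ^ k), D j = 0 ∧
    ((2 : ℝ) ^ k) ^ (1 + δ) ≤ ∑ j ∈ Finset.range (2 * 2 ^ k), D j ^ 2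

theorem greenAmp_upper_bound {ε : ℤ → ℤ} (hε : ∀ y, ε y = 1 ∨ ε y = -1) {o : ℤ} {δ : ℝ}
    (hδ : 0 < δ) {k : ℕ} {D : ℕ → ℝ} (hD : ∀ j : ℕ, D (j + 1) - D j = ε (2 ^ k + j + 1))
    (hsum : ∑ j ∈ Finset.range (2 * 2 ^ k), D j = 0)
    (hT : ((2 : ℝ) ^ k) ^ (1 + δ) ≤ ∑ j ∈ Finset.range (2 * 2 ^ k), D j ^ 2)
    (ho : |o| ≤ 2 ^ k) {r θ x : ℝ} (hr : 1 / 2 ≤ r) (hr1 : r < 1) (hθ0 : 0 < |θ|) (hθ1 : |θ| ≤ 1)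
    (hrθ : 1 - r ≤ θ ^ 2) (hx1 : (2 : ℝ) ^ k ≤ x) (hx2 : x < 2 ^ (k + 1)) (hx : x * |θ| ≤ 1) :
    (greenAmp ε o r θ o).re ≤ 1536 * x + 192000 * 2 ^ (1 + δ) * (x ^ (-(1 + δ)) / θ ^ 2) := by
  have hG := isGreenPair_greenAmp hε o (by linarith : 0 ≤ r) hr1 θ
  have hm := greenAmp_mass_pos (by linarith : 0 ≤ r) hr1 θ
  have hA := greenAmp_re_nonneg hε o (by linarith : 0 < r) hr1 θ
  have hκ : 0 < r / 3 := by linarith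
  have hκ6 : (1 : ℝ) / 6 ≤ r / 3 := by linarith
  have hθne : θ ≠ 0 := abs_pos.1 hθ0
  have hL0 : (0 : ℝ) < 2 ^ k := by positivity
  have hx0 : 0 < x := lt_of_lt_of_le hL0 hx1
  have hθ2 : 0 < θ ^ 2 := by rw [← sq_abs]; positivity
  -- The rows of the window are within 3·2^k of 0 and `o` is within 2^k, hence the radius 4·2^k.
  have hwin := hG.window_bound (abs_intCast_le_one_of_sign hε) hm hκ (s := 2 ^ k)
    (n := 2 * 2 ^ k) hD hsum (R := 4 * 2 ^ k) (by push_cast; linarith) (by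
      intro j hj
      have hj' : (j : ℝ) ≤ 2 * 2 ^ k := by exact_mod_cast hj
      have ho' : |(o : ℝ)| ≤ 2 ^ k := by exact_mod_cast ho
      have := abs_le.1 ho'
      have hj0 : (0 : ℝ) ≤ j := Nat.cast_nonneg j
      push_cast
      rw [abs_le]
      constructor <;> linarith)
  set a := (greenAmp ε o r θ o).re
  set T := ∑ j ∈ Finset.range (2 * 2 ^ k), D j ^ 2
  set L : ℝ := 2 ^ k
  have hpos1 : 0 ≤ 1536 * x := by positivity
  have hpos2 : 0 ≤ 192000 * 2 ^ (1 + δ) * (x ^ (-(1 + δ)) / θ ^ 2) := by positivity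
  -- If the peak is too small for the window bound, then A(o) is at most of order L ≤ x, which is
  -- the first term of the estimate.
  by_cases hbig : 64 * (4 * L) ≤ r / 3 * a
  · have h1 := hwin hbig
    have hcos2 := Real.one_sub_sq_div_two_le_cos (x := θ)
    have hm2 : 1 - r + r / 3 * (1 - Real.cos θ) ≤ 2 * θ ^ 2 := by
      have : r / 3 * (1 - Real.cos θ) ≤ r / 3 * (θ ^ 2 / 2) := by gcongr; linarith
      nlinarith [sq_nonneg θ]
    have hLθ : θ ^ 2 * L ^ 2 ≤ 1 := by
      have : L * |θ| ≤ 1 := (mul_le_mul_of_nonneg_right hx1 hθ0.le).trans hx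
      rw [← sq_abs θ, ← mul_pow]
      exact pow_le_one₀ (by positivity) (by linarith)
    have h2 : 16 * ((1 - r + r / 3 * (1 - Real.cos θ)) * (4 * L) ^ 2 + r / 3) ≤ 528 := by
      have : (1 - r + r / 3 * (1 - Real.cos θ)) * (4 * L) ^ 2 ≤ 2 * θ ^ 2 * (4 * L) ^ 2 := by gcongr
      nlinarith
    have hsin := sq_le_ten_mul_sin_sq hθ1
    have hτ : θ ^ 2 / 360 ≤ (r / 3 * Real.sin θ) ^ 2 := by
      have : (1 / 6 : ℝ) ^ 2 ≤ (r / 3) ^ 2 := by gcongr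
      rw [mul_pow]
      calc θ ^ 2 / 360 ≤ (1 / 6) ^ 2 * Real.sin θ ^ 2 := by linarith
        _ ≤ _ := by gcongr
    have hT2 : x ^ (1 + δ) / 2 ^ (1 + δ) ≤ T := by
      refine le_trans ?_ hT
      rw [← Real.div_rpow hx0.le (by norm_num)]
      refine Real.rpow_le_rpow (by positivity) ?_ (by linarith)
      rw [pow_succ] at hx2
      change x < L * 2 at hx2
      linarith
    have h3 : θ ^ 2 / 360 * (x ^ (1 + δ) / 2 ^ (1 + δ)) * a ≤ 528 := by
      refine le_trans ?_ (h1.trans h2)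
      gcongr
    have h4 : a ≤ 190080 * 2 ^ (1 + δ) * (x ^ (-(1 + δ)) / θ ^ 2) := by
      rw [Real.rpow_neg hx0.le]
      have hxp : 0 < x ^ (1 + δ) := by positivity
      have h2p : (0 : ℝ) < 2 ^ (1 + δ) := by positivity
      have e : a = θ ^ 2 / 360 * (x ^ (1 + δ) / 2 ^ (1 + δ)) * a *
          (360 * 2 ^ (1 + δ) * ((x ^ (1 + δ))⁻¹ / θ ^ 2)) := by field_simp
      rw [e]
      calc _ ≤ 528 * (360 * 2 ^ (1 + δ) * ((x ^ (1 + δ))⁻¹ / θ ^ 2)) := by gcongr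
        _ = _ := by ring
    have h5 : 190080 * 2 ^ (1 + δ) * (x ^ (-(1 + δ)) / θ ^ 2) ≤
        192000 * 2 ^ (1 + δ) * (x ^ (-(1 + δ)) / θ ^ 2) := by gcongr; norm_num
    linarith
  · push Not at hbig
    have : 1 / 6 * a ≤ r / 3 * a := by gcongr
    linarith

theorem HasSpreadWindows.exists_bound {ε : ℤ → ℤ} (hε : ∀ y, ε y = 1 ∨ ε y = -1) {δ : ℝ}
    (hδ : 0 < δ) {k₀ : ℕ} (hw : HasSpreadWindows ε δ k₀) (o : ℤ) :
    ∃ C p q : ℝ, 0 ≤ C ∧ p < 1 ∧ q < 1 ∧ ∀ r θ : ℝ, 1 / 2 ≤ r → r < 1 → |θ| ≤ Real.pi →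
      0 < |θ| → 1 - r ≤ θ ^ 2 →
      (greenAmp ε o r θ o).re ≤ C * (1 + |θ| ^ (-p) + |θ| ^ (-q)) := by
  -- With x = |θ|^(-p), the two terms of the window estimate are of order |θ|^(-p) and |θ|^(-(1 -
  -- δ/2)); both exponents exceed -1.
  set p := (2 + δ) / (2 * (1 + δ)) with hp
  have hp0 : 0 < p := by positivity
  have hp1 : p < 1 := by rw [hp, div_lt_one (by positivity)]; linarith
  have hpδ : p * (1 + δ) = 1 + δ / 2 := by rw [hp]; field_simp
  obtain ⟨K₁, hK₁⟩ := pow_unbounded_of_one_lt (|o| : ℤ) (by norm_num : (1 : ℤ) < 2)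
  set K := max K₁ k₀ with hK
  -- Below this threshold |θ|^(-p) ≥ 2^(K+1), so its dyadic scale `k` is at least `K`: the window is
  -- spread and |o| ≤ 2^k.
  set θ₀ : ℝ := ((2 : ℝ) ^ (K + 1)) ^ (-(1 / p)) with hθ₀
  have hθ₀0 : 0 < θ₀ := by positivity
  have hθ₀1 : θ₀ ≤ 1 := Real.rpow_le_one_of_one_le_of_nonpos (one_le_pow₀ (by norm_num))
    (by rw [neg_nonpos]; positivity)
  have h2δ : (0 : ℝ) < 2 ^ (1 + δ) := by positivity
  refine ⟨1536 + 192000 * 2 ^ (1 + δ) + 54 / θ₀, p, 1 - δ / 2, by positivity, hp1, by linarith, ?_⟩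
  intro r θ hr hr1 hθπ hθ0 hrθ
  set C := 1536 + 192000 * 2 ^ (1 + δ) + 54 / θ₀ with hC
  have hpos1 : 0 ≤ |θ| ^ (-p) := by positivity
  have hpos2 : 0 ≤ |θ| ^ (-(1 - δ / 2)) := by positivity
  have hCpos : 0 ≤ 54 / θ₀ := by positivity
  by_cases hθ : |θ| ≤ θ₀
  · have hx1 : (2 : ℝ) ^ (K + 1) ≤ |θ| ^ (-p) := by
      have e : (2 : ℝ) ^ (K + 1) = θ₀ ^ (-p) := by
        rw [hθ₀, ← Real.rpow_mul (by positivity)]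
        have : -(1 / p) * -p = 1 := by field_simp
        rw [this, Real.rpow_one]
      rw [e]
      exact Real.rpow_le_rpow_of_nonpos hθ0 hθ (by linarith)
    obtain ⟨k, hk1, hk2⟩ := exists_nat_pow_near (x := |θ| ^ (-p)) (y := 2)
      (le_trans (one_le_pow₀ (by norm_num)) hx1) (by norm_num)
    have hKk : K ≤ k := by
      have := hx1.trans_lt hk2
      have := (pow_lt_pow_iff_right₀ (by norm_num : (1 : ℝ) < 2)).1 this
      omega
    obtain ⟨D, hD1, hD2, hD3⟩ := hw k ((le_max_right _ _).trans hKk)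
    have ho : |o| ≤ 2 ^ k := hK₁.le.trans
      (pow_le_pow_right₀ (by norm_num) ((le_max_left _ _).trans hKk))
    have hθ1 := hθ.trans hθ₀1
    have hxθ : |θ| ^ (-p) * |θ| ≤ 1 := by
      rw [← Real.rpow_add_one hθ0.ne']
      exact Real.rpow_le_one hθ0.le hθ1 (by linarith)
    have hb := greenAmp_upper_bound hε hδ hD1 hD2 hD3 ho hr hr1 hθ0 hθ1 hrθ hk1 hk2 hxθ
    have e : (|θ| ^ (-p)) ^ (-(1 + δ)) / θ ^ 2 = |θ| ^ (-(1 - δ / 2)) := by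
      rw [← Real.rpow_mul hθ0.le, ← sq_abs θ, ← Real.rpow_natCast |θ| 2, ← Real.rpow_sub hθ0]
      congr 1
      push_cast
      linarith
    rw [e] at hb
    have hCx : 1536 * |θ| ^ (-p) ≤ C * |θ| ^ (-p) := by gcongr; rw [hC]; linarith
    have hCy : 192000 * 2 ^ (1 + δ) * |θ| ^ (-(1 - δ / 2)) ≤ C * |θ| ^ (-(1 - δ / 2)) := by
      gcongr; rw [hC]; linarith
    have : 0 ≤ C := by positivity
    linarith
  · push Not at hθ
    have hb := greenAmp_sq_le hε o hr hr1 (θ := θ) (b := θ₀ ^ 2 / 30) (by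
      have h1 := sq_div_le_one_sub_cos hθπ
      have h2 : r / 3 * (θ ^ 2 / 5) ≤ r / 3 * (1 - Real.cos θ) := by gcongr
      have h3 : θ₀ ^ 2 ≤ θ ^ 2 := by rw [← sq_abs θ]; gcongr
      nlinarith)
    have hle : (greenAmp ε o r θ o).re ≤ 54 / θ₀ := by
      refine abs_le_of_sq_le_sq' ?_ (by positivity) |>.2
      rw [div_pow, le_div_iff₀ (by positivity)]
      linarith
    have h1 : C * 1 ≤ C * (1 + |θ| ^ (-p) + |θ| ^ (-(1 - δ / 2))) :=
      mul_le_mul_of_nonneg_left (by linarith) (by positivity)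
    linarith

theorem intervalIntegrable_abs_rpow_neg {p : ℝ} (hp : p < 1) (b : ℝ) :
    IntervalIntegrable (fun θ : ℝ => |θ| ^ (-p)) volume (-b) b := by
  have h1 : ∀ b : ℝ, 0 ≤ b → IntervalIntegrable (fun θ : ℝ => |θ| ^ (-p)) volume 0 b := by
    intro b hb
    refine (intervalIntegral.intervalIntegrable_rpow' (r := -p) (by linarith)).congr ?_
    intro θ hθ
    rw [Set.uIoc_of_le hb] at hθ
    simp [abs_of_pos hθ.1]
  have h2 : ∀ b : ℝ, IntervalIntegrable (fun θ : ℝ => |θ| ^ (-p)) volume 0 b := by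
    intro b
    rcases le_total 0 b with hb | hb
    · exact h1 b hb
    · have := (IntervalIntegrable.iff_comp_neg).1 (h1 (-b) (by linarith))
      simpa using this
  exact (h2 (-b)).symm.trans (h2 b)

theorem HasSpreadWindows.walkTransient {ε : ℤ → ℤ} (hε : ∀ y, ε y = 1 ∨ ε y = -1) {δ : ℝ}
    (hδ : 0 < δ) {k₀ : ℕ} (hw : HasSpreadWindows ε δ k₀) : WalkTransient ε := by
  intro u
  rw [returnProb_lt_one_iff_summable]
  obtain ⟨C, p, q, hC, hp, hq, hb⟩ := hw.exists_bound hε hδ u.2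
  set dom : ℝ → ℝ := fun θ => C * (1 + |θ| ^ (-p) + |θ| ^ (-q)) with hdom
  have hdomint : IntervalIntegrable dom volume (-Real.pi) Real.pi :=
    ((intervalIntegrable_const.add (intervalIntegrable_abs_rpow_neg hp _)).add
      (intervalIntegrable_abs_rpow_neg hq _)).const_mul C
  have hpi := Real.pi_pos
  have hunif : ∀ r : ℝ, 1 / 2 ≤ r → r < 1 →
      ∫ θ in -Real.pi..Real.pi, (greenAmp ε u.2 r θ u.2).re ≤
        (∫ θ in -Real.pi..Real.pi, dom θ) + 20 := by
    intro r hr hr1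
    set ρ := √(1 - r) with hρ
    have hρ0 : 0 < ρ := Real.sqrt_pos.2 (by linarith)
    have hρ2 : ρ ^ 2 = 1 - r := Real.sq_sqrt (by linarith)
    -- On |θ| ≤ √(1 - r) the crude bound is at most 10/√(1 - r); over an interval of length 2√(1 -
    -- r) it costs at most 20, uniformly in `r`.
    set ind : ℝ → ℝ := (Set.Icc (-ρ) ρ).indicator fun _ => 10 / ρ with hind
    have hindI : Integrable ind volume :=
      (integrable_indicator_iff measurableSet_Icc).2 (by simp)
    have hindint : ∫ θ in -Real.pi..Real.pi, ind θ ≤ 20 := by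
      rw [intervalIntegral.integral_of_le (by linarith)]
      refine (setIntegral_le_integral hindI (Eventually.of_forall fun θ =>
        Set.indicator_nonneg (fun _ _ => by positivity) θ)).trans ?_
      rw [hind, integral_indicator_const _ measurableSet_Icc, Real.volume_real_Icc_of_le
        (by linarith), smul_eq_mul]
      have : (ρ - -ρ) * (10 / ρ) = 20 := by field_simp; norm_num
      exact this.le
    have hcont : Continuous fun θ => (greenAmp ε u.2 r θ u.2).re :=
      Complex.continuous_re.comp (continuous_greenAmp ε u.2 (by linarith : 0 ≤ r) hr1 u.2)
    have hmono : ∫ θ in -Real.pi..Real.pi, (greenAmp ε u.2 r θ u.2).re ≤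
        ∫ θ in -Real.pi..Real.pi, (dom θ + ind θ) := by
      refine intervalIntegral.integral_mono_on (by linarith) (hcont.intervalIntegrable _ _)
        (hdomint.add hindI.intervalIntegrable) fun θ hθ => ?_
      have hdom0 : 0 ≤ dom θ := by simp only [hdom]; positivity
      by_cases hθρ : |θ| ≤ ρ
      · have hin : ind θ = 10 / ρ := Set.indicator_of_mem (Set.mem_Icc.2 (abs_le.1 hθρ)) _
        have h1 := greenAmp_sq_le hε u.2 hr hr1 (θ := θ) (b := 1 - r) (by
          have := mul_nonneg (by linarith : (0 : ℝ) ≤ r / 3) (sub_nonneg.2 (Real.cos_le_one θ))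
          linarith)
        rw [← hρ2] at h1
        have h2 : (greenAmp ε u.2 r θ u.2).re ≤ 10 / ρ := by
          refine abs_le_of_sq_le_sq' ?_ (by positivity) |>.2
          rw [div_pow, le_div_iff₀ (by positivity)]
          linarith
        linarith
      · push Not at hθρ
        have hin : 0 ≤ ind θ := Set.indicator_nonneg (fun _ _ => by positivity) θ
        have h1 := hb r θ hr hr1 (abs_le.2 hθ) (hρ0.trans hθρ) (by
          rw [← hρ2, ← sq_abs θ]; gcongr)
        simp only [hdom] at *
        linarith
    rw [intervalIntegral.integral_add hdomint hindI.intervalIntegrable] at hmono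
    linarith
  refine summable_of_sum_range_le
    (c := ((∫ θ in -Real.pi..Real.pi, dom θ) + 20) / (2 * Real.pi))
    (fun n => stepProb_nonneg ε u n u) fun N => ?_
  -- The bound is uniform in `r`, so letting r tend to 1 in each finite partial sum removes the
  -- discount.
  have htend : Tendsto (fun r : ℝ => ∑ n ∈ Finset.range N, r ^ n * (2 * Real.pi * stepProb ε u n u))
      (nhdsWithin 1 (Set.Iio 1))
      (nhds (∑ n ∈ Finset.range N, (1 : ℝ) ^ n * (2 * Real.pi * stepProb ε u n u))) := by
    refine Tendsto.mono_left (Continuous.tendsto ?_ 1) nhdsWithin_le_nhds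
    fun_prop
  have hle := le_of_tendsto htend (b := (∫ θ in -Real.pi..Real.pi, dom θ) + 20) (by
    have : Set.Ico (1 / 2 : ℝ) 1 ∈ nhdsWithin (1 : ℝ) (Set.Iio 1) :=
      Ico_mem_nhdsLT (by norm_num)
    filter_upwards [this] with r hr
    refine (sum_le_hasSum _ (fun n _ => ?_) (hasSum_stepProb ε u
      (by linarith [hr.1] : 0 ≤ r) hr.2)).trans (hunif r hr.1 hr.2)
    have := stepProb_nonneg ε u n u
    have : 0 ≤ r := by linarith [hr.1]
    positivity)
  simp only [one_pow, one_mul, ← Finset.mul_sum] at hle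
  rw [le_div_iff₀ (by positivity)]
  linarith

/-! ### Independence and small-ball estimates -/

/-- It suffices to test on the π-systems of measurable rectangles, where the probability factors
first between the two families and then within each. -/
theorem iIndepFun_prodMk_of_indepFun {ι Ω α β : Type*} [MeasurableSpace Ω] [MeasurableSpace α]
    [MeasurableSpace β] {μ : Measure Ω} {X : ι → Ω → α} {Y : ι → Ω → β}
    (hX : ∀ i, Measurable (X i)) (hY : ∀ i, Measurable (Y i)) (hXi : iIndepFun X μ)
    (hYi : iIndepFun Y μ) (hXY : IndepFun (fun ω i => X i ω) (fun ω i => Y i ω) μ) :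
    iIndepFun (fun i ω => (X i ω, Y i ω)) μ := by
  rw [iIndepFun_iff_iIndep]
  set R : Set (Set (α × β)) :=
    Set.image2 (· ×ˢ ·) {s : Set α | MeasurableSet s} {t : Set β | MeasurableSet t}
  refine iIndepSets.iIndep (fun i => ((hX i).prodMk (hY i)).comap_le)
    (fun i => Set.preimage (fun ω => (X i ω, Y i ω)) '' R)
    (fun i => isPiSystem_prod.comap _) (fun i => ?_) ?_
  · rw [← MeasurableSpace.comap_generateFrom, generateFrom_prod]
  · rw [iIndepSets_iff]
    intro s f hf
    have hrect : ∀ i, ∃ a : Set α, ∃ b : Set β, MeasurableSet a ∧ MeasurableSet b ∧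
        (i ∈ s → f i = X i ⁻¹' a ∩ Y i ⁻¹' b) := by
      intro i
      by_cases hi : i ∈ s
      · obtain ⟨_, ⟨a, ha, b, hb, rfl⟩, h2⟩ := hf i hi
        refine ⟨a, b, ha, hb, fun _ => ?_⟩
        rw [← h2]
        ext ω; simp
      · exact ⟨∅, ∅, .empty, .empty, fun h => absurd h hi⟩
    choose a b ha hb hab using hrect
    have hm1 : MeasurableSet (⋂ i ∈ s, (fun x : ι → α => x i) ⁻¹' a i) :=
      Finset.measurableSet_biInter s fun i _ => measurable_pi_apply i (ha i)
    have hm2 : MeasurableSet (⋂ i ∈ s, (fun x : ι → β => x i) ⁻¹' b i) :=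
      Finset.measurableSet_biInter s fun i _ => measurable_pi_apply i (hb i)
    have h1 := hXY.measure_inter_preimage_eq_mul _ _ hm1 hm2
    have hx := hXi.measure_inter_preimage_eq_mul s (sets := a) fun i _ => ha i
    have hy := hYi.measure_inter_preimage_eq_mul s (sets := b) fun i _ => hb i
    have h2 : ∀ i ∈ s, μ (f i) = μ (X i ⁻¹' a i) * μ (Y i ⁻¹' b i) := by
      intro i hi
      rw [hab i hi]
      exact hXY.measure_inter_preimage_eq_mul _ _ (measurable_pi_apply i (ha i))
        (measurable_pi_apply i (hb i))
    rw [Finset.prod_congr rfl h2, Finset.prod_mul_distrib, ← hx, ← hy]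
    simp only [Set.preimage_iInter] at h1
    refine Eq.trans ?_ h1
    congr 1
    ext ω
    simp only [Set.mem_iInter, Set.mem_inter_iff, Set.mem_preimage]
    constructor
    · intro h
      refine ⟨fun i hi => ?_, fun i hi => ?_⟩
      · have := h i hi; rw [hab i hi] at this; exact this.1
      · have := h i hi; rw [hab i hi] at this; exact this.2
    · rintro ⟨h1, h2⟩ i hi
      rw [hab i hi]
      exact ⟨h1 i hi, h2 i hi⟩

/-- The integrand is π-periodic, and on [-π/2, π/2] one has sin²θ ≥ θ²/4, which leaves a Gaussian
integral. -/
theorem integral_exp_neg_mul_sin_sq_le {P : ℝ} (hP : 0 < P) :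
    ∫ θ in -Real.pi..Real.pi, Real.exp (-(P / 2) * Real.sin θ ^ 2) ≤ 4 * Real.pi / √P := by
  set g : ℝ → ℝ := fun θ => Real.exp (-(P / 2) * Real.sin θ ^ 2) with hg
  have hgc : Continuous g := by fun_prop
  have hper : Function.Periodic g Real.pi := by
    intro θ; simp [hg, Real.sin_add_pi]
  have hpi := Real.pi_pos
  have hsplit : ∫ θ in -Real.pi..Real.pi, g θ = 2 * ∫ θ in -(Real.pi / 2)..Real.pi / 2, g θ := by
    rw [← intervalIntegral.integral_add_adjacent_intervals (b := 0)
      (hgc.intervalIntegrable _ _) (hgc.intervalIntegrable _ _)]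
    have h1 := hper.intervalIntegral_add_eq (-Real.pi) (-(Real.pi / 2))
    have h2 := hper.intervalIntegral_add_eq 0 (-(Real.pi / 2))
    have e1 : -Real.pi + Real.pi = 0 := by ring
    have e2 : -(Real.pi / 2) + Real.pi = Real.pi / 2 := by ring
    rw [e1, e2] at h1
    rw [zero_add, e2] at h2
    rw [h1, h2]; ring
  have hint : Integrable fun θ : ℝ => Real.exp (-(P / 8) * θ ^ 2) :=
    integrable_exp_neg_mul_sq (by positivity)
  have hle : ∫ θ in -(Real.pi / 2)..Real.pi / 2, g θ ≤ √(Real.pi / (P / 8)) := by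
    rw [← integral_gaussian]
    refine le_trans (intervalIntegral.integral_mono_on (by linarith)
      (hgc.intervalIntegrable _ _) hint.intervalIntegrable fun θ hθ => ?_) ?_
    · simp only [hg]
      refine Real.exp_le_exp.2 ?_
      have h1 := Real.mul_abs_le_abs_sin (x := θ) (abs_le.2 hθ)
      have h2 : (1 : ℝ) / 2 ≤ 2 / Real.pi := by
        rw [div_le_div_iff₀ (by norm_num) hpi]
        linarith [Real.pi_le_four]
      have h3 : 1 / 2 * |θ| ≤ |Real.sin θ| :=
        (mul_le_mul_of_nonneg_right h2 (abs_nonneg _)).trans h1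
      have h4 : (1 / 2 * |θ|) ^ 2 ≤ |Real.sin θ| ^ 2 := by gcongr
      rw [mul_pow, sq_abs, sq_abs] at h4
      nlinarith
    · rw [intervalIntegral.integral_of_le (by linarith)]
      exact setIntegral_le_integral hint (Eventually.of_forall fun θ => (Real.exp_pos _).le)
  rw [hsplit]
  have hs : √(Real.pi / (P / 8)) ≤ 2 * Real.pi / √P := by
    rw [Real.sqrt_le_left (by positivity), div_pow, Real.sq_sqrt hP.le]
    rw [div_le_div_iff₀ (by positivity) hP]
    nlinarith [Real.pi_gt_three, mul_pos hP hpi]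
  calc 2 * ∫ θ in -(Real.pi / 2)..Real.pi / 2, g θ ≤ 2 * (2 * Real.pi / √P) := by linarith
    _ = _ := by ring

section SmallBall

variable {Ω : Type*} [MeasurableSpace Ω] {μ : Measure Ω} [IsProbabilityMeasure μ]
  {ε : ℤ → Ω → ℤ}

/-- The squared modulus is cos²θ + E²sin²θ with E the mean, and E² ≤ (1 - p)² ≤ 1 - p bounds it by 1
- p sin²θ. -/
theorem norm_integral_exp_sign_le {X : Ω → ℤ} (hX : Measurable X)
    (hval : ∀ ω, X ω = 1 ∨ X ω = -1) {p : ℝ} (hp0 : 0 ≤ p) (hp1 : p ≤ 1)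
    (hmean : |∫ ω, (X ω : ℝ) ∂μ| ≤ 1 - p) (θ : ℝ) :
    ‖∫ ω, Complex.exp ((X ω : ℂ) * θ * Complex.I) ∂μ‖ ≤
      Real.exp (-(p / 2) * Real.sin θ ^ 2) := by
  have hexp : ∀ ω, Complex.exp ((X ω : ℂ) * θ * Complex.I) =
      (Real.cos θ : ℂ) + Real.sin θ * Complex.I * ((X ω : ℝ) : ℂ) := by
    intro ω
    rcases hval ω with h | h
    · simp [h, Complex.exp_mul_I]
    · simp only [h, Int.cast_neg, Int.cast_one, neg_mul, one_mul, Complex.ofReal_neg,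
        Complex.ofReal_one, mul_neg, mul_one]
      rw [← neg_mul, Complex.exp_mul_I]
      simp
  have hXr : Integrable (fun ω => (X ω : ℝ)) μ :=
    Integrable.of_bound (by fun_prop) 1 (Eventually.of_forall fun ω => by
      rcases hval ω with h | h <;> simp [h])
  have hval2 : ∫ ω, Complex.exp ((X ω : ℂ) * θ * Complex.I) ∂μ =
      (Real.cos θ : ℂ) + ((Real.sin θ * ∫ ω, (X ω : ℝ) ∂μ : ℝ) : ℂ) * Complex.I := by
    simp only [hexp]
    rw [integral_add (integrable_const _) (hXr.ofReal.const_mul _), integral_const_mul,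
      integral_const, probReal_univ, one_smul, integral_complex_ofReal, Complex.ofReal_mul]
    ring
  set E := ∫ ω, (X ω : ℝ) ∂μ
  rw [hval2, Complex.norm_add_mul_I, Real.sqrt_le_left (Real.exp_pos _).le]
  have hE : E ^ 2 ≤ (1 - p) ^ 2 := by rw [← sq_abs]; gcongr
  have h1 : Real.cos θ ^ 2 + (Real.sin θ * E) ^ 2 ≤ 1 - p * Real.sin θ ^ 2 := by
    have h2 : (Real.sin θ * E) ^ 2 ≤ Real.sin θ ^ 2 * (1 - p) := by
      rw [mul_pow]
      refine mul_le_mul_of_nonneg_left (hE.trans ?_) (sq_nonneg _)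
      nlinarith
    nlinarith [Real.sin_sq_add_cos_sq θ]
  refine h1.trans ?_
  rw [← Real.exp_nat_mul]
  have := Real.add_one_le_exp (-(p * Real.sin θ ^ 2))
  calc 1 - p * Real.sin θ ^ 2 ≤ Real.exp (-(p * Real.sin θ ^ 2)) := by linarith
    _ = _ := by congr 1; push_cast; ring

variable (hmeas : ∀ y, Measurable (ε y)) (hval : ∀ y ω, ε y ω = 1 ∨ ε y ω = -1)
  (hind : iIndepFun ε μ) {p : ℤ → ℝ} (hp0 : ∀ y, 0 ≤ p y) (hp1 : ∀ y, p y ≤ 1)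
  (hmean : ∀ y, |∫ ω, (ε y ω : ℝ) ∂μ| ≤ 1 - p y)
include hmeas hval hind hp0 hp1 hmean

theorem norm_integral_exp_sum_sign_le (s : Finset ℤ) (θ : ℝ) :
    ‖∫ ω, Complex.exp (((∑ y ∈ s, ε y ω : ℤ) : ℂ) * θ * Complex.I) ∂μ‖ ≤
      Real.exp (-((∑ y ∈ s, p y) / 2) * Real.sin θ ^ 2) := by
  have hs : iIndepFun (fun i : s => ε i) μ := hind.precomp Subtype.val_injective
  have h1 := hs.integral_fun_prod_comp
    (f := fun _ (k : ℤ) => Complex.exp ((k : ℂ) * θ * Complex.I)) (fun i => (hmeas i).aemeasurable)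
    (fun i => (measurable_of_countable _).aestronglyMeasurable)
  have e : ∀ ω, Complex.exp (((∑ y ∈ s, ε y ω : ℤ) : ℂ) * θ * Complex.I) =
      ∏ i : s, Complex.exp ((ε i ω : ℂ) * θ * Complex.I) := by
    intro ω
    rw [← Complex.exp_sum, Finset.sum_coe_sort s (fun y => (ε y ω : ℂ) * θ * Complex.I)]
    push_cast
    rw [Finset.sum_mul, Finset.sum_mul]
  simp only [e]
  rw [h1, norm_prod]
  refine (Finset.prod_le_prod (fun i _ => norm_nonneg _) fun (i : s) _ =>
    norm_integral_exp_sign_le (hmeas (i : ℤ)) (hval i) (hp0 i) (hp1 i) (hmean i) θ).trans ?_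
  rw [← Real.exp_sum, Finset.sum_coe_sort s (fun y => -(p y / 2) * Real.sin θ ^ 2),
    ← Finset.sum_mul, Finset.sum_neg_distrib, Finset.sum_div]

/-- Fourier inversion: the point probability is at most the average over frequencies of the modulus
of the characteristic function, which independence turns into a product. -/
theorem measure_sum_sign_eq_le (s : Finset ℤ) (hP : 0 < ∑ y ∈ s, p y) (k : ℤ) :
    μ.real {ω | ∑ y ∈ s, ε y ω = k} ≤ 2 / √(∑ y ∈ s, p y) := by
  set X : Ω → ℤ := fun ω => ∑ y ∈ s, ε y ω with hX
  have hXm : Measurable X := Finset.measurable_sum s fun y _ => hmeas y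
  have hset : MeasurableSet {ω | X ω = k} := hXm (measurableSet_singleton k)
  have hjm : Measurable (fun z : ℝ × Ω =>
      Complex.exp (((X z.2 - k : ℤ) : ℂ) * z.1 * Complex.I)) := by
    have h1 : Measurable fun z : ℝ × Ω => ((X z.2 - k : ℤ) : ℂ) :=
      (measurable_of_countable (fun j : ℤ => ((j - k : ℤ) : ℂ))).comp (hXm.comp measurable_snd)
    have h2 : Measurable fun z : ℝ × Ω => (z.1 : ℂ) := Complex.measurable_ofReal.comp measurable_fst
    exact Complex.measurable_exp.comp ((h1.mul h2).mul_const _)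
  have hnorm : ∀ (j : ℤ) (θ : ℝ), ‖Complex.exp ((j : ℂ) * θ * Complex.I)‖ = 1 := by
    intro j θ
    rw [show (j : ℂ) * θ * Complex.I = ((j * θ : ℝ) : ℂ) * Complex.I by push_cast; ring,
      Complex.norm_exp_ofReal_mul_I]
  have hfin : IsFiniteMeasure (volume.restrict (Set.uIoc (-Real.pi) Real.pi)) :=
    ⟨by rw [Measure.restrict_apply_univ, Set.uIoc]; exact measure_Ioc_lt_top⟩
  have hswap := intervalIntegral_integral_swap (μ := μ) (a := -Real.pi) (b := Real.pi)
    (f := fun θ ω => Complex.exp (((X ω - k : ℤ) : ℂ) * θ * Complex.I))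
    (Integrable.of_bound hjm.aestronglyMeasurable 1
      (Eventually.of_forall fun z => (hnorm _ _).le))
  have hR : ∫ ω, (∫ θ in -Real.pi..Real.pi,
      Complex.exp (((X ω - k : ℤ) : ℂ) * θ * Complex.I)) ∂μ =
      ((2 * Real.pi * μ.real {ω | X ω = k} : ℝ) : ℂ) := by
    simp only [integral_exp_int_mul, sub_eq_zero]
    have : (fun ω => if X ω = k then 2 * (Real.pi : ℂ) else 0) =
        {ω | X ω = k}.indicator fun _ => 2 * (Real.pi : ℂ) := by
      ext ω; simp [Set.indicator_apply]
    rw [this, integral_indicator_const _ hset]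
    simp
    ring
  have hL : ‖∫ θ in -Real.pi..Real.pi,
      ∫ ω, Complex.exp (((X ω - k : ℤ) : ℂ) * θ * Complex.I) ∂μ‖ ≤
      ∫ θ in -Real.pi..Real.pi, Real.exp (-((∑ y ∈ s, p y) / 2) * Real.sin θ ^ 2) := by
    refine intervalIntegral.norm_integral_le_of_norm_le (by linarith [Real.pi_pos])
      (Eventually.of_forall fun θ _ => ?_)
      (Continuous.intervalIntegrable (by fun_prop) _ _)
    have e : ∀ ω, Complex.exp (((X ω - k : ℤ) : ℂ) * θ * Complex.I) =
        Complex.exp ((X ω : ℂ) * θ * Complex.I) *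
          Complex.exp (((-k : ℤ) : ℂ) * θ * Complex.I) := by
      intro ω
      rw [← Complex.exp_add]
      push_cast
      ring_nf
    simp only [e]
    rw [integral_mul_const, norm_mul, hnorm, mul_one]
    exact norm_integral_exp_sum_sign_le hmeas hval hind hp0 hp1 hmean s θ
  rw [hswap, hR, Complex.norm_real, Real.norm_of_nonneg
    (mul_nonneg (by positivity) measureReal_nonneg)] at hL
  have h3 := hL.trans (integral_exp_neg_mul_sin_sq_le hP)
  have h4 : 2 * Real.pi * μ.real {ω | X ω = k} ≤ 2 * Real.pi * (2 / √(∑ y ∈ s, p y)) := by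
    refine h3.trans (le_of_eq ?_)
    ring
  exact le_of_mul_le_mul_left h4 (by positivity)

theorem measure_abs_sum_sign_le (s : Finset ℤ) (hP : 0 < ∑ y ∈ s, p y) {t : ℝ} (ht : 0 ≤ t) :
    μ.real {ω | |((∑ y ∈ s, ε y ω : ℤ) : ℝ)| ≤ t} ≤ (2 * t + 1) * (2 / √(∑ y ∈ s, p y)) := by
  have hsub : {ω | |((∑ y ∈ s, ε y ω : ℤ) : ℝ)| ≤ t} ⊆
      ⋃ k ∈ Finset.Icc (-(⌊t⌋₊ : ℤ)) ⌊t⌋₊, {ω | ∑ y ∈ s, ε y ω = k} := by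
    intro ω hω
    simp only [Set.mem_iUnion]
    refine ⟨_, ?_, rfl⟩
    have h1 : ((|∑ y ∈ s, ε y ω|.toNat : ℕ) : ℝ) ≤ t := by
      have : ((|∑ y ∈ s, ε y ω|.toNat : ℕ) : ℤ) = |∑ y ∈ s, ε y ω| :=
        Int.toNat_of_nonneg (abs_nonneg _)
      have h2 : ((|∑ y ∈ s, ε y ω|.toNat : ℕ) : ℝ) = ((|∑ y ∈ s, ε y ω| : ℤ) : ℝ) := by
        exact_mod_cast congrArg (Int.cast (R := ℝ)) this
      rw [h2, Int.cast_abs]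
      exact hω
    have h2 := Nat.le_floor h1
    rw [Finset.mem_Icc, ← abs_le]
    have h3 := abs_nonneg (∑ y ∈ s, ε y ω)
    omega
  refine (measureReal_mono hsub (measure_ne_top _ _)).trans ?_
  refine (measureReal_biUnion_finset_le _ _).trans ?_
  refine (Finset.sum_le_sum fun k _ =>
    measure_sum_sign_eq_le hmeas hval hind hp0 hp1 hmean s hP k).trans ?_
  rw [Finset.sum_const, nsmul_eq_mul]
  refine mul_le_mul_of_nonneg_right ?_ (by positivity)
  have hc : (Finset.Icc (-(⌊t⌋₊ : ℤ)) ⌊t⌋₊).card = 2 * ⌊t⌋₊ + 1 := by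
    rw [Int.card_Icc]; omega
  rw [hc]
  push_cast
  linarith [Nat.floor_le ht]

end SmallBall

/-! ### Almost sure existence of spread windows -/

/-- The `L` consecutive rows that follow the row `L + j`. -/
def rowBlock (L j : ℕ) : Finset ℤ :=
  (Finset.range L).map ⟨fun i : ℕ => (L : ℤ) + j + i + 1, fun a b h => by simpa using h⟩

theorem sum_rowBlock {M : Type*} [AddCommMonoid M] (φ : ℤ → M) (L j : ℕ) :
    ∑ y ∈ rowBlock L j, φ y = ∑ i ∈ Finset.range L, φ ((L : ℤ) + j + i + 1) := by
  rw [rowBlock, Finset.sum_map]; rfl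

theorem exists_centred_partial_sums (ε : ℤ → ℤ) {L : ℕ} (hL : 0 < L) :
    ∃ D : ℕ → ℝ, (∀ j : ℕ, D (j + 1) - D j = ε (L + j + 1)) ∧
      ∑ j ∈ Finset.range (2 * L), D j = 0 ∧
      (∑ j ∈ Finset.range L, ((∑ y ∈ rowBlock L j, ε y : ℤ) : ℝ) ^ 2) / 2 ≤
        ∑ j ∈ Finset.range (2 * L), D j ^ 2 := by
  set S : ℕ → ℝ := fun j => ∑ i ∈ Finset.range j, (ε (L + i + 1) : ℝ) with hS
  set a : ℝ := (∑ j ∈ Finset.range (2 * L), S j) / (2 * L) with ha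
  have hL' : (0 : ℝ) < L := by exact_mod_cast hL
  -- Subtracting the mean does not change S(L + j) - S(j), a block sum, and its square is at most
  -- twice the sum of the squares of the two centred values.
  refine ⟨fun j => S j - a, fun j => ?_, ?_, ?_⟩
  · simp [hS, Finset.sum_range_succ]
  · rw [Finset.sum_sub_distrib, Finset.sum_const, Finset.card_range, nsmul_eq_mul, ha]
    push_cast
    field_simp
    ring
  · rw [two_mul L, Finset.sum_range_add, ← Finset.sum_add_distrib, Finset.sum_div]
    refine Finset.sum_le_sum fun j _ => ?_
    have e : ((∑ y ∈ rowBlock L j, ε y : ℤ) : ℝ) = S (L + j) - S j := by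
      rw [sum_rowBlock, add_comm L j]
      simp only [hS]
      rw [Finset.sum_range_add]
      push_cast
      simp only [add_sub_cancel_left, add_assoc]
    rw [e]
    nlinarith [sq_nonneg ((S (L + j) - a) + (S j - a))]

/-- Chebyshev's inequality for the counting measure: fewer than half the indices can have |x j| > t.
-/
theorem half_le_sum_indicator {L : ℕ} {x : ℕ → ℝ} {V t : ℝ} (ht : 0 < t) (hVt : 4 * V ≤ L * t ^ 2)
    (hx : ∑ j ∈ Finset.range L, x j ^ 2 < 2 * V) :
    (L : ℝ) / 2 ≤ ∑ j ∈ Finset.range L, if |x j| ≤ t then (1 : ℝ) else 0 := by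
  have h1 : ∀ j, 1 - x j ^ 2 / t ^ 2 ≤ if |x j| ≤ t then (1 : ℝ) else 0 := by
    intro j
    split_ifs with h
    · have : 0 ≤ x j ^ 2 / t ^ 2 := by positivity
      linarith
    · push Not at h
      have : 1 ≤ x j ^ 2 / t ^ 2 := by
        rw [le_div_iff₀ (by positivity), one_mul, ← sq_abs (x j)]
        gcongr
      linarith
  refine le_trans ?_ (Finset.sum_le_sum fun j _ => h1 j)
  rw [Finset.sum_sub_distrib, ← Finset.sum_div, Finset.sum_const, Finset.card_range, nsmul_eq_mul,
    mul_one]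
  have : (∑ j ∈ Finset.range L, x j ^ 2) / t ^ 2 ≤ L / 2 := by
    rw [div_le_iff₀ (by positivity)]
    linarith
  linarith

section SpreadWindows

variable {Ω : Type*} [MeasurableSpace Ω] {μ : Measure Ω} [IsProbabilityMeasure μ]
  {ε : ℤ → Ω → ℤ} (hmeas : ∀ y, Measurable (ε y)) (hval : ∀ y ω, ε y ω = 1 ∨ ε y ω = -1)
  (hind : iIndepFun ε μ) {p : ℤ → ℝ} (hp0 : ∀ y, 0 ≤ p y) (hp1 : ∀ y, p y ≤ 1)
  (hmean : ∀ y, |∫ ω, (ε y ω : ℝ) ∂μ| ≤ 1 - p y)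
include hmeas hval hind hp0 hp1 hmean

/-- A small spread forces half the block sums to be at most `t` in modulus; Markov's inequality for
their number needs only a first moment, so the overlap of the blocks is harmless. -/
theorem measure_small_spread_le {L : ℕ} (hL : 0 < L) {P t V : ℝ} (hP : 0 < P)
    (hPle : ∀ j < L, P ≤ ∑ y ∈ rowBlock L j, p y) (ht : 0 < t) (hVt : 4 * V ≤ L * t ^ 2) :
    μ.real {ω | ∑ j ∈ Finset.range L, ((∑ y ∈ rowBlock L j, ε y ω : ℤ) : ℝ) ^ 2 < 2 * V} ≤
      2 * ((2 * t + 1) * (2 / √P)) := by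
  have hL' : (0 : ℝ) < L := by exact_mod_cast hL
  set X : ℕ → Ω → ℝ := fun j ω => ((∑ y ∈ rowBlock L j, ε y ω : ℤ) : ℝ) with hX
  have hXm : ∀ j, Measurable (X j) := fun j =>
    (measurable_of_countable (fun k : ℤ => (k : ℝ))).comp
      (Finset.measurable_sum _ fun y _ => hmeas y)
  have hsm : ∀ j, MeasurableSet {ω | |X j ω| ≤ t} := fun j =>
    measurableSet_le (hXm j).abs measurable_const
  have hifeq : ∀ j, (fun ω => if |X j ω| ≤ t then (1 : ℝ) else 0) =
      {ω | |X j ω| ≤ t}.indicator 1 := by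
    intro j; ext ω; simp [Set.indicator_apply]
  have hint : ∀ j, Integrable (fun ω => if |X j ω| ≤ t then (1 : ℝ) else 0) μ := by
    intro j
    rw [hifeq]
    exact (integrable_const (1 : ℝ)).indicator (hsm j)
  have hmarkov := mul_meas_ge_le_integral_of_nonneg (μ := μ)
    (f := fun ω => ∑ j ∈ Finset.range L, if |X j ω| ≤ t then (1 : ℝ) else 0)
    (Eventually.of_forall fun ω => Finset.sum_nonneg fun j _ => by split_ifs <;> norm_num)
    (integrable_finsetSum _ fun j _ => hint j) ((L : ℝ) / 2)
  rw [integral_finsetSum _ fun j _ => hint j] at hmarkov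
  have hterm : ∀ j ∈ Finset.range L, ∫ ω, (if |X j ω| ≤ t then (1 : ℝ) else 0) ∂μ ≤
      (2 * t + 1) * (2 / √P) := by
    intro j hj
    have hPj := hPle j (Finset.mem_range.1 hj)
    rw [hifeq, integral_indicator_one (hsm j)]
    refine (measure_abs_sum_sign_le hmeas hval hind hp0 hp1 hmean (rowBlock L j)
      (hP.trans_le hPj) ht.le).trans ?_
    gcongr
  have hsum := hmarkov.trans (Finset.sum_le_sum hterm)
  rw [Finset.sum_const, Finset.card_range, nsmul_eq_mul] at hsum
  have hsub : μ.real {ω | ∑ j ∈ Finset.range L, X j ω ^ 2 < 2 * V} ≤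
      μ.real {ω | (L : ℝ) / 2 ≤ ∑ j ∈ Finset.range L, if |X j ω| ≤ t then (1 : ℝ) else 0} :=
    measureReal_mono (fun ω hω => half_le_sum_indicator ht hVt hω) (measure_ne_top _ _)
  have h2 : (L : ℝ) / 2 * μ.real {ω | ∑ j ∈ Finset.range L, X j ω ^ 2 < 2 * V} ≤
      (L : ℝ) / 2 * (2 * ((2 * t + 1) * (2 / √P))) := by
    refine (mul_le_mul_of_nonneg_left hsub (by positivity)).trans (hsum.trans (le_of_eq ?_))
    ring
  exact le_of_mul_le_mul_left h2 (by positivity)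

theorem ae_exists_hasSpreadWindows {c γ : ℝ} (hc : 0 < c) (hγ : 0 < γ) {K : ℕ}
    (hlow : ∀ k ≥ K, ∀ y : ℤ, 2 ^ k < y → y ≤ 3 * 2 ^ k → c * ((2 : ℝ) ^ k) ^ (γ - 1) ≤ p y) :
    ∀ᵐ ω ∂μ, ∃ k₀, HasSpreadWindows (fun y => ε y ω) (γ / 2) k₀ := by
  set bad : ℕ → Set Ω := fun k => {ω | ∑ j ∈ Finset.range (2 ^ k),
    ((∑ y ∈ rowBlock (2 ^ k) j, ε y ω : ℤ) : ℝ) ^ 2 < 2 * ((2 : ℝ) ^ k) ^ (1 + γ / 2)} with hbad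
  set q : ℝ := 2 ^ (-(γ / 4)) with hq
  have hq0 : 0 < q := by positivity
  have hq1 : q < 1 := Real.rpow_lt_one_of_one_lt_of_neg (by norm_num) (by linarith)
  have hbound : ∀ k ≥ K, μ.real (bad k) ≤ 20 / √c * q ^ k := by
    intro k hk
    set x : ℝ := 2 ^ k with hx
    have hx1 : 1 ≤ x := one_le_pow₀ (by norm_num)
    have hx0 : 0 < x := by positivity
    have hcast : ((2 ^ k : ℕ) : ℝ) = x := by push_cast; rfl
    have h := measure_small_spread_le hmeas hval hind hp0 hp1 hmean (L := 2 ^ k) (by positivity)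
      -- With these choices 4V equals L t², and t/√P is of order x^(-γ/4), which is summable along x
      -- = 2^k.
      (P := c * x ^ γ) (t := 2 * x ^ (γ / 4)) (V := x ^ (1 + γ / 2)) (by positivity) (by
        intro j hj
        rw [sum_rowBlock]
        have hterm : ∀ i ∈ Finset.range (2 ^ k),
            c * x ^ (γ - 1) ≤ p (((2 ^ k : ℕ) : ℤ) + j + i + 1) := by
          intro i hi
          have hi' := Finset.mem_range.1 hi
          refine hlow k hk _ ?_ ?_
          · push_cast; omega
          · have h1 : (i : ℤ) < 2 ^ k := by exact_mod_cast hi'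
            have h2 : (j : ℤ) < 2 ^ k := by exact_mod_cast hj
            push_cast; omega
        refine le_trans (le_of_eq ?_) (Finset.sum_le_sum hterm)
        rw [Finset.sum_const, Finset.card_range, nsmul_eq_mul, hcast]
        rw [show x * (c * x ^ (γ - 1)) = c * (x ^ (γ - 1) * x) by ring,
          ← Real.rpow_add_one hx0.ne']
        congr 2; ring) (by positivity) (by
        rw [hcast, mul_pow, ← Real.rpow_natCast (x ^ (γ / 4)) 2, ← Real.rpow_mul hx0.le,
          show (1 + γ / 2 : ℝ) = γ / 2 + 1 by ring, Real.rpow_add_one hx0.ne']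
        rw [show γ / 4 * ((2 : ℕ) : ℝ) = γ / 2 by push_cast; ring]
        exact le_of_eq (by ring))
    refine h.trans ?_
    have hxg : 1 ≤ x ^ (γ / 4) := Real.one_le_rpow hx1 (by positivity)
    have hsq : √(c * x ^ γ) = √c * (x ^ (γ / 4) * x ^ (γ / 4)) := by
      rw [Real.sqrt_mul hc.le, ← Real.rpow_add hx0, Real.sqrt_eq_rpow (x ^ γ),
        ← Real.rpow_mul hx0.le]
      congr 2; ring
    have hqk : q ^ k = (x ^ (γ / 4))⁻¹ := by
      rw [hq, hx, ← Real.rpow_natCast, ← Real.rpow_mul (by norm_num), ← Real.rpow_natCast 2 k,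
        ← Real.rpow_mul (by norm_num), ← Real.rpow_neg (by norm_num)]
      congr 1; ring
    rw [hsq, hqk]
    set z := x ^ (γ / 4)
    have hz : 0 < z := by linarith
    have hsc : 0 < √c := Real.sqrt_pos.2 hc
    calc 2 * ((2 * (2 * z) + 1) * (2 / (√c * (z * z))))
        ≤ 2 * ((5 * z) * (2 / (√c * (z * z)))) := by gcongr; linarith
      _ = 20 / √c * z⁻¹ := by field_simp; norm_num
  have hsum : ∑' k, μ (bad (k + K)) ≠ ∞ := by
    have hs : Summable fun k => 20 / √c * q ^ (k + K) := by
      simp only [pow_add]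
      exact ((summable_geometric_of_lt_one hq0.le hq1).mul_right _).mul_left _
    refine ne_top_of_le_ne_top (hs.tsum_ofReal_ne_top) (ENNReal.tsum_le_tsum fun k => ?_)
    rw [← ofReal_measureReal (measure_ne_top μ _)]
    exact ENNReal.ofReal_le_ofReal (hbound _ (Nat.le_add_left _ _))
  filter_upwards [ae_eventually_notMem hsum] with ω hω
  obtain ⟨k₁, hk₁⟩ := eventually_atTop.1 hω
  refine ⟨k₁ + K, fun k hk => ?_⟩
  have hk' := hk₁ (k - K) (by omega)
  rw [Nat.sub_add_cancel (by omega)] at hk'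
  obtain ⟨D, h1, h2, h3⟩ := exists_centred_partial_sums (fun y => ε y ω) (L := 2 ^ k)
    (by positivity)
  refine ⟨D, fun j => ?_, h2, ?_⟩
  · rw [h1]; push_cast; rfl
  · simp only [hbad, Set.mem_ofPred_eq, not_lt] at hk'
    refine le_trans ?_ h3
    linarith

end SpreadWindows

/-! ### Bounded primitives of periodic sequences and their finite perturbations -/

theorem Function.Periodic.sum_range_shift_eq {f : ℤ → ℤ} {Q : ℕ} (hf : Function.Periodic f (Q : ℤ))
    (y : ℤ) : ∑ i ∈ Finset.range Q, f (y + 1 + i) = ∑ i ∈ Finset.range Q, f (y + i) := by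
  have h1 := Finset.sum_range_succ (fun i : ℕ => f (y + i)) Q
  rw [Finset.sum_range_succ', hf y] at h1
  simp only [Nat.cast_add, Nat.cast_one, Nat.cast_zero, add_zero] at h1
  have h2 := add_right_cancel h1
  rw [← h2]
  exact Finset.sum_congr rfl fun i _ => by congr 1; ring

theorem Function.Periodic.sum_range_eq_zero {f : ℤ → ℤ} {Q : ℕ}
    (hf : Function.Periodic f (Q : ℤ)) (hsum : ∑ y ∈ Finset.Icc (1 : ℤ) (Q : ℤ), f y = 0)
    (y : ℤ) : ∑ i ∈ Finset.range Q, f (y + i) = 0 := by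
  have h1 : ∑ i ∈ Finset.range Q, f (1 + i) = 0 := by
    rw [← hsum]
    refine Finset.sum_bij' (fun i _ => (1 + i : ℤ)) (fun y _ => (y - 1).toNat) ?_ ?_ ?_ ?_ ?_
    · intro i hi
      rw [Finset.mem_range] at hi
      rw [Finset.mem_Icc]
      omega
    · intro y hy
      rw [Finset.mem_Icc] at hy
      rw [Finset.mem_range]
      omega
    · intro i hi; simp
    · intro y hy
      rw [Finset.mem_Icc] at hy
      omega
    · intro i hi; rfl
  induction y using Int.induction_on with
  | zero => rw [← hf.sum_range_shift_eq]; simpa using h1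
  | succ n ih => rw [hf.sum_range_shift_eq]; exact ih
  | pred n ih =>
    rw [← hf.sum_range_shift_eq, sub_add_cancel]; exact ih

/-- A periodic sequence of signs of zero mean has a bounded primitive. -/
theorem Function.Periodic.exists_bounded_primitive {f : ℤ → ℤ} {Q : ℕ} (hQ : 0 < Q)
    (hf1 : ∀ y, f y = 1 ∨ f y = -1) (hf : Function.Periodic f (Q : ℤ))
    (hsum : ∑ y ∈ Finset.Icc (1 : ℤ) (Q : ℤ), f y = 0) :
    ∃ F : ℤ → ℝ, ∃ C : ℝ, (∀ y, F (y + 1) - F y = f y) ∧ ∀ y, |F y| ≤ C := by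
  have hQ' : (0 : ℝ) < Q := by exact_mod_cast hQ
  -- This weighted average over one period is bounded by construction. Shifting `y` by one changes
  -- the numerator by Q f(y) minus a full period sum, which is zero.
  refine ⟨fun y => (∑ i ∈ Finset.range Q, (i : ℝ) * f (y + i)) / Q,
    (∑ i ∈ Finset.range Q, (i : ℝ)) / Q, fun y => ?_, fun y => ?_⟩
  · have h0 : ∑ i ∈ Finset.range Q, (f (y + i) : ℝ) = 0 := by
      exact_mod_cast hf.sum_range_eq_zero hsum y
    have h1 := Finset.sum_range_succ (fun i : ℕ => (i : ℝ) * f (y + i)) Q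
    rw [Finset.sum_range_succ', hf y] at h1
    have e : ∑ i ∈ Finset.range Q, ((i + 1 : ℕ) : ℝ) * f (y + (i + 1 : ℕ)) =
        ∑ i ∈ Finset.range Q, (i : ℝ) * f (y + 1 + i) +
        ∑ i ∈ Finset.range Q, (f (y + 1 + i) : ℝ) := by
      rw [← Finset.sum_add_distrib]
      refine Finset.sum_congr rfl fun i _ => ?_
      rw [show y + ((i + 1 : ℕ) : ℤ) = y + 1 + i by push_cast; ring]
      push_cast
      ring
    have h2 : ∑ i ∈ Finset.range Q, (f (y + 1 + i) : ℝ) = 0 := by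
      exact_mod_cast hf.sum_range_eq_zero hsum (y + 1)
    rw [e, h2] at h1
    rw [← sub_div, div_eq_iff hQ'.ne']
    simp at h1
    linarith
  · rw [abs_div, abs_of_pos hQ']
    gcongr
    refine (Finset.abs_sum_le_sum_abs _ _).trans (Finset.sum_le_sum fun i _ => ?_)
    rw [abs_mul, Nat.abs_cast]
    exact mul_le_of_le_one_right (Nat.cast_nonneg i) (abs_intCast_le_one_of_sign hf1 _)

/-- Changing a sequence at finitely many places keeps the existence of a bounded primitive. -/
theorem exists_bounded_primitive_of_finite {f ε : ℤ → ℤ}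
    (hf : ∃ F : ℤ → ℝ, ∃ C : ℝ, (∀ y, F (y + 1) - F y = f y) ∧ ∀ y, |F y| ≤ C)
    (hfin : {y | ε y ≠ f y}.Finite) :
    ∃ F : ℤ → ℝ, ∃ C : ℝ, (∀ y, F (y + 1) - F y = ε y) ∧ ∀ y, |F y| ≤ C := by
  classical
  obtain ⟨F, C, hF, hC⟩ := hf
  set s := hfin.toFinset with hs
  refine ⟨fun y => F y + ∑ z ∈ s, if z < y then ((ε z : ℝ) - f z) else 0,
    C + ∑ z ∈ s, |(ε z : ℝ) - f z|, fun y => ?_, fun y => ?_⟩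
  · have e : ∑ z ∈ s, (if z < y + 1 then ((ε z : ℝ) - f z) else 0) -
        ∑ z ∈ s, (if z < y then ((ε z : ℝ) - f z) else 0) = ε y - f y := by
      rw [← Finset.sum_sub_distrib]
      have h1 : ∀ z ∈ s, ((if z < y + 1 then ((ε z : ℝ) - f z) else 0) -
          if z < y then ((ε z : ℝ) - f z) else 0) = if z = y then ((ε y : ℝ) - f y) else 0 := by
        intro z _
        rcases lt_trichotomy z y with h | h | h
        · rw [if_pos (by omega), if_pos h, if_neg (by omega), sub_self]
        · subst h; simp
        · rw [if_neg (by omega), if_neg (by omega), if_neg (by omega), sub_self]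
      rw [Finset.sum_congr rfl h1, Finset.sum_ite_eq']
      split_ifs with hy
      · rfl
      · have : ε y = f y := by simpa [hs] using hy
        rw [this, sub_self]
    have := hF y
    linarith
  · refine (abs_add_le _ _).trans (add_le_add (hC y) ?_)
    refine (Finset.abs_sum_le_sum_abs _ _).trans (Finset.sum_le_sum fun z _ => ?_)
    split_ifs
    · exact le_rfl
    · simp

/-! ### Law of the orientations and decay of the defect probabilities -/

theorem orientation_sign {Ω : Type*} {f : ℤ → ℤ} {rho lam : ℤ → Ω → ℤ} (hf : ∀ y, f y = 1 ∨ f y = -1)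
    (hrho_val : ∀ y ω, rho y ω = 1 ∨ rho y ω = -1)
    (hlam_val : ∀ y ω, lam y ω = 0 ∨ lam y ω = 1) (y : ℤ) (ω : Ω) :
    orientation f (fun y => lam y ω) (fun y => rho y ω) y = 1 ∨
      orientation f (fun y => lam y ω) (fun y => rho y ω) y = -1 := by
  rcases hlam_val y ω with h | h
  · simpa [orientation, h] using hf y
  · simpa [orientation, h] using hrho_val y ω

section Orientation

variable {Ω : Type*} [MeasurableSpace Ω] {μ : Measure Ω} {f : ℤ → ℤ} {rho lam : ℤ → Ω → ℤ}

theorem integral_lam_eq (hlam_meas : ∀ y, Measurable (lam y))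
    (hlam_val : ∀ y ω, lam y ω = 0 ∨ lam y ω = 1) (y : ℤ) :
    ∫ ω, (lam y ω : ℝ) ∂μ = μ.real {ω | lam y ω = 1} := by
  have hm : MeasurableSet {ω | lam y ω = 1} := hlam_meas y (measurableSet_singleton 1)
  have e : (fun ω => (lam y ω : ℝ)) = {ω | lam y ω = 1}.indicator 1 := by
    ext ω
    rcases hlam_val y ω with h | h <;> simp [h]
  rw [e, integral_indicator_one hm]

variable [IsProbabilityMeasure μ]

theorem integral_rho_eq_zero (hrho_meas : ∀ y, Measurable (rho y))
    (hrho_val : ∀ y ω, rho y ω = 1 ∨ rho y ω = -1)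
    (hrho_unif : ∀ y, μ.real {ω | rho y ω = 1} = 1 / 2) (y : ℤ) :
    ∫ ω, (rho y ω : ℝ) ∂μ = 0 := by
  have hm : MeasurableSet {ω | rho y ω = 1} := hrho_meas y (measurableSet_singleton 1)
  have e : (fun ω => (rho y ω : ℝ)) = fun ω => 2 * {ω | rho y ω = 1}.indicator 1 ω - 1 := by
    ext ω
    rcases hrho_val y ω with h | h
    · simp [h]; norm_num
    · simp [h]
  have hI : Integrable (fun ω => 2 * {ω | rho y ω = 1}.indicator (1 : Ω → ℝ) ω) μ :=
    ((integrable_const (1 : ℝ)).indicator hm).const_mul 2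
  rw [e, integral_sub hI (integrable_const _), integral_const_mul, integral_indicator_one hm, hrho_unif]
  simp

/-- By independence the defect contributes E[λρ] = 0, so the mean is (1 - P(λ = 1)) f(y): the defect
probability plays the role of `p y` in the small-ball estimates. -/
theorem abs_integral_orientation_le (hf : ∀ y, f y = 1 ∨ f y = -1)
    (hrho_meas : ∀ y, Measurable (rho y)) (hrho_val : ∀ y ω, rho y ω = 1 ∨ rho y ω = -1)
    (hrho_unif : ∀ y, μ.real {ω | rho y ω = 1} = 1 / 2)
    (hlam_meas : ∀ y, Measurable (lam y)) (hlam_val : ∀ y ω, lam y ω = 0 ∨ lam y ω = 1)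
    (hindep : IndepFun (fun ω y => lam y ω) (fun ω y => rho y ω) μ) (y : ℤ) :
    |∫ ω, (orientation f (fun y => lam y ω) (fun y => rho y ω) y : ℝ) ∂μ| ≤
      1 - μ.real {ω | lam y ω = 1} := by
  have hprod : ∫ ω, (lam y ω : ℝ) * (rho y ω : ℝ) ∂μ = 0 := by
    have h := (hindep.comp (measurable_pi_apply y) (measurable_pi_apply y)).integral_fun_comp_mul_comp
      (f := fun k : ℤ => (k : ℝ)) (g := fun k : ℤ => (k : ℝ)) (hlam_meas y).aemeasurable
      (hrho_meas y).aemeasurable (measurable_of_countable _).aestronglyMeasurable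
      (measurable_of_countable _).aestronglyMeasurable
    have h0 := integral_rho_eq_zero hrho_meas hrho_val hrho_unif y
    simp only [Function.comp_apply] at h
    rw [h, h0, mul_zero]
  have hlamI : Integrable (fun ω => (lam y ω : ℝ)) μ := by
    have := hlam_meas y
    refine Integrable.of_bound (by fun_prop) 1 (Eventually.of_forall fun ω => ?_)
    rcases hlam_val y ω with h | h <;> simp [h]
  have hprodI : Integrable (fun ω => (lam y ω : ℝ) * (rho y ω : ℝ)) μ := by
    have := hlam_meas y
    have := hrho_meas y
    refine Integrable.of_bound (by fun_prop) 1 (Eventually.of_forall fun ω => ?_)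
    rcases hlam_val y ω with h | h <;> rcases hrho_val y ω with h' | h' <;> simp [h, h']
  have e : (fun ω => (orientation f (fun y => lam y ω) (fun y => rho y ω) y : ℝ)) =
      fun ω => (1 - (lam y ω : ℝ)) * f y + (lam y ω : ℝ) * (rho y ω : ℝ) := by
    ext ω; simp [orientation]
  have hdiffI : Integrable (fun ω => (1 - (lam y ω : ℝ)) * f y) μ :=
    ((integrable_const (1 : ℝ)).sub hlamI).mul_const _
  rw [e, integral_add hdiffI hprodI, hprod, add_zero,
    integral_mul_const, integral_sub (integrable_const _) hlamI,
    integral_lam_eq hlam_meas hlam_val, abs_mul]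
  have h1 : |(f y : ℝ)| = 1 := by rcases hf y with h | h <;> simp [h]
  rw [h1, mul_one]
  simp only [integral_const, probReal_univ, smul_eq_mul, mul_one]
  rw [abs_of_nonneg (sub_nonneg.2 measureReal_le_one)]

end Orientation

theorem exists_lower_bound_of_isEquivalent {p : ℤ → ℝ} {β c : ℝ} (hc : 0 < c) (hβ : β < 1)
    (h : Asymptotics.IsEquivalent cofinite p fun y : ℤ => c / |(y : ℝ)| ^ β) :
    ∃ c' γ : ℝ, 0 < c' ∧ 0 < γ ∧ ∃ K : ℕ, ∀ k ≥ K, ∀ y : ℤ, 2 ^ k < y → y ≤ 3 * 2 ^ k →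
      c' * ((2 : ℝ) ^ k) ^ (γ - 1) ≤ p y := by
  obtain ⟨φ, hφ, hpφ⟩ := h.exists_eq_mul
  have hev : ∀ᶠ y : ℤ in cofinite, c / 2 / |(y : ℝ)| ^ β ≤ p y := by
    filter_upwards [hpφ, hφ.eventually (lt_mem_nhds (by norm_num : (1 / 2 : ℝ) < 1))] with y h1 h2
    rw [h1, Pi.mul_apply]
    calc c / 2 / |(y : ℝ)| ^ β = 1 / 2 * (c / |(y : ℝ)| ^ β) := by ring
      _ ≤ _ := by gcongr
  rw [Int.cofinite_eq, eventually_sup] at hev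
  obtain ⟨Y, hY⟩ := eventually_atTop.1 hev.2
  obtain ⟨K, hK⟩ := pow_unbounded_of_one_lt Y (by norm_num : (1 : ℤ) < 2)
  -- Replacing β by a nonnegative exponent still less than 1 makes |y|^b monotone on the window, so
  -- one bound covers all signs of β; γ is then 1 - b > 0.
  set b := max β 0 with hb
  have hb0 : 0 ≤ b := le_max_right _ _
  have hb1 : b < 1 := max_lt hβ one_pos
  refine ⟨c / 6, 1 - b, by positivity, by linarith, K, fun k hk y hy1 hy2 => ?_⟩
  have hkK : (2 : ℤ) ^ K ≤ 2 ^ k := pow_le_pow_right₀ (by norm_num) hk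
  refine le_trans ?_ (hY y (by linarith))
  set x : ℝ := 2 ^ k with hx
  have hx1 : 1 ≤ x := one_le_pow₀ (by norm_num)
  have hx0 : 0 < x := by linarith
  have hy1' : x ≤ y := by rw [hx]; exact_mod_cast hy1.le
  have hy2' : (y : ℝ) ≤ 3 * x := by rw [hx]; exact_mod_cast hy2
  have hy0 : (0 : ℝ) < y := by linarith
  rw [abs_of_pos hy0]
  have hle : (y : ℝ) ^ β ≤ 3 * x ^ b := by
    calc (y : ℝ) ^ β ≤ (y : ℝ) ^ b :=
          Real.rpow_le_rpow_of_exponent_le (by linarith) (le_max_left _ _)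
      _ ≤ (3 * x) ^ b := Real.rpow_le_rpow hy0.le hy2' hb0
      _ = 3 ^ b * x ^ b := Real.mul_rpow (by norm_num) hx0.le
      _ ≤ 3 ^ (1 : ℝ) * x ^ b := by
          gcongr
          · norm_num
      _ = _ := by rw [Real.rpow_one]
  rw [show (1 - b - 1 : ℝ) = -b by ring, Real.rpow_neg hx0.le]
  calc c / 6 * (x ^ b)⁻¹ = c / 2 / (3 * x ^ b) := by field_simp; norm_num
    _ ≤ c / 2 / (y : ℝ) ^ β := by gcongr

theorem summable_of_isEquivalent_div_rpow {p : ℤ → ℝ} {β c : ℝ} (hβ : 1 < β)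
    (h : Asymptotics.IsEquivalent cofinite p fun y : ℤ => c / |(y : ℝ)| ^ β) : Summable p := by
  have hs : Summable fun y : ℤ => c / |(y : ℝ)| ^ β := by
    have := (Real.summable_abs_int_rpow hβ).mul_left c
    refine this.congr fun y => ?_
    rw [Real.rpow_neg (abs_nonneg _), div_eq_mul_inv]
  exact summable_of_isBigO hs h.isBigO

theorem theorem1p2 {Ω : Type*} [MeasurableSpace Ω] (μ : Measure Ω) [IsProbabilityMeasure μ]
    (Q : ℕ) (hQ : 2 ≤ Q) (hQeven : Even Q)
    (f : ℤ → ℤ) (hf : ∀ y, f y = 1 ∨ f y = -1) (hfper : Function.Periodic f (Q : ℤ))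
    (hfsum : ∑ y ∈ Finset.Icc (1 : ℤ) (Q : ℤ), f y = 0)
    (rho : ℤ → Ω → ℤ) (hrho_meas : ∀ y, Measurable (rho y))
    (hrho_val : ∀ y ω, rho y ω = 1 ∨ rho y ω = -1)
    (hrho_unif : ∀ y, μ.real {ω | rho y ω = 1} = 1 / 2)
    (hrho_indep : iIndepFun rho μ)
    (lam : ℤ → Ω → ℤ) (hlam_meas : ∀ y, Measurable (lam y))
    (hlam_val : ∀ y ω, lam y ω = 0 ∨ lam y ω = 1)
    (hlam_indep : iIndepFun lam μ)
    (hindep : IndepFun (fun ω y => lam y ω) (fun ω y => rho y ω) μ)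
    (β c : ℝ)
    (hdecay : Asymptotics.IsEquivalent cofinite
      (fun y : ℤ => μ.real {ω | lam y ω = 1}) (fun y : ℤ => c / |(y : ℝ)| ^ β)) :
    (0 < c → β < 1 →
      ∀ᵐ ω ∂μ, WalkTransient (orientation f (fun y => lam y ω) (fun y => rho y ω))) ∧
    (1 < β →
      ∀ᵐ ω ∂μ, WalkRecurrent (orientation f (fun y => lam y ω) (fun y => rho y ω))) := by
  have hsign := fun ω y => orientation_sign (f := f) hf hrho_val hlam_val y ω
  refine ⟨fun hc hβ => ?_, fun hβ => ?_⟩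
  · obtain ⟨c', γ, hc', hγ, K, hK⟩ := exists_lower_bound_of_isEquivalent hc hβ hdecay
    have hind : iIndepFun
        (fun y ω => orientation f (fun y => lam y ω) (fun y => rho y ω) y) μ :=
      (iIndepFun_prodMk_of_indepFun hlam_meas hrho_meas hlam_indep hrho_indep hindep).comp
        (fun y (z : ℤ × ℤ) => (1 - z.1) * f y + z.1 * z.2) fun y => measurable_of_countable _
    have hmeas : ∀ y, Measurable
        fun ω => orientation f (fun y => lam y ω) (fun y => rho y ω) y := fun y =>
      (measurable_of_countable fun z : ℤ × ℤ => (1 - z.1) * f y + z.1 * z.2).comp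
        ((hlam_meas y).prodMk (hrho_meas y))
    filter_upwards [ae_exists_hasSpreadWindows hmeas (fun y ω => hsign ω y) hind
      (fun y => measureReal_nonneg) (fun y => measureReal_le_one)
      (abs_integral_orientation_le hf hrho_meas hrho_val hrho_unif hlam_meas hlam_val hindep)
      hc' hγ hK] with ω hω
    obtain ⟨k₀, hk₀⟩ := hω
    exact hk₀.walkTransient (hsign ω) (by linarith)
  · have hsum : ∑' y, μ {ω | lam y ω = 1} ≠ ∞ := by
      have h := (summable_of_isEquivalent_div_rpow hβ hdecay).tsum_ofReal_ne_top
      simpa only [ofReal_measureReal (measure_ne_top μ _)] using h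
    filter_upwards [ae_finite_setOfPred_mem hsum] with ω hω
    have hfin : {y | orientation f (fun y => lam y ω) (fun y => rho y ω) y ≠ f y}.Finite := by
      refine hω.subset fun y hy => ?_
      rcases hlam_val y ω with h | h
      · exact absurd (by simp [orientation, h]) hy
      · exact h
    obtain ⟨F, C, hF, hC⟩ := exists_bounded_primitive_of_finite
      (hfper.exists_bounded_primitive (by omega) hf hfsum) hfin
    exact walkRecurrent_of_bounded_primitive (hsign ω) hF hC
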